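/- Let $(\mathsf X,\Sigma)$ be a measurable space with a $\sigma$-finite dominating measure $dx$, let $\pi(dx)=\pi(x)\,dx$ be a probability distribution on $\mathsf X$, and let $Q(x,dx')=q(x,x')\,dx'$ be a Markov proposal kernel with a jointly measurable density $q\ge 0$. Put $r(x,x')=\pi(x')q(x',x)/\{\pi(x)q(x,x')\}$. Let $1\le s\le m$ be integers and, for each $x\in\mathsf X$ (measurably in $x$), let $(W_1,\dots,W_m)$ be a random vector in $[0,\infty)^m$ whose law $q_x^{(m)}(dw)$ is exchangeable (invariant under permutations of the coordinates) and satisfies $E(W_i)=1$ for every $i$. Let $q_x^{(s)}$ denote the law of $(W_1,\dots,W_s)$. For $k\in\{s,m\}$ and $w\in[0,\infty)^k$ write $\bar w=(w_1+\dots+w_k)/k$. Let $P_k$ be the pseudo-marginal Metropolis--Hastings kernel on $\mathsf X\times[0,\infty)^k$ which, from $(x,w)$, proposes $(x',w')\sim q(x,x')\,dx'\,q_{x'}^{(k)}(dw')$, accepts it with probability $$\alpha_k(x,w;x',w')=1\wedge\{r(x,x')\,\bar w'/\bar w\}$$ (taken to be $1$ if $\pi(x)q(x,x')\bar w=0$),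 and otherwise stays at $(x,w)$. Let $\tilde\pi_k(dx,dw)=\pi(dx)\,q_x^{(k)}(dw)\,\bar w$ be its stationary distribution. For $\varphi\in L^2(\pi)$, regarded as a function of the $x$-coordinate only, let $$\mathrm{var}(\varphi,P_k)=\lim_{n\to\infty}\mathrm{Var}\Big\{n^{-1/2}\sum_{j=1}^n\varphi(X_j)\Big\}\in[0,\infty],$$ where $(X_j,\underline W_j)_{j\ge0}$ is the Markov chain with kernel $P_k$ and initial law $\tilde\pi_k$. Then, for every real-valued $\varphi\in L^2(\pi)$, both limits exist in $[0,\infty]$ and $$s\{\mathrm{var}(\varphi,P_s)+\mathrm{Var}_\pi(\varphi)\}\;\le\; m\{\mathrm{var}(\varphi,P_m)+\mathrm{Var}_\pi(\varphi)\}.$$ -/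

import Mathlib

open MeasureTheory ProbabilityTheory Filter Topology
open scoped ENNReal NNReal

namespace PseudoMarginal

section Chain

variable {S : Type*} [MeasurableSpace S]

/-- The law on `ℕ → S` of the time-homogeneous Markov chain with initial law `μ` and
transition kernel `P` (Ionescu-Tulcea). -/
noncomputable def chainLaw (μ : Measure S) (P : Kernel S S) [IsMarkovKernel P] :
    Measure (ℕ → S) :=
  (μ.map (fun z (_ : Finset.Iic (0 : ℕ)) => z)).bind
    (Kernel.traj (X := fun _ : ℕ => S)
      (fun n => P.comap (fun h => h ⟨n, Finset.mem_Iic.2 le_rfl⟩) (measurable_pi_apply _)) 0)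

/-- `var {n^{-1/2} ∑_{k=1}^n f (Z_k)}` for the chain `Z` with `Z_0 ∼ μ` and kernel `P`. -/
noncomputable def scaledVar (μ : Measure S) (P : Kernel S S) [IsMarkovKernel P]
    (f : S → ℝ) (n : ℕ) : ℝ≥0∞ :=
  evariance (fun ω : ℕ → S => (√(n : ℝ))⁻¹ * ∑ k ∈ Finset.Icc 1 n, f (ω k)) (chainLaw μ P)

/-- The asymptotic variance of the ergodic averages of `f`, with values in `[0, ∞]`. -/
noncomputable def asympVar (μ : Measure S) (P : Kernel S S) [IsMarkovKernel P]
    (f : S → ℝ) : ℝ≥0∞ :=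
  limUnder atTop (scaledVar μ P f)

/-- The accept-reject kernel
`P(z, dz') = {1 - α(z)} δ_z(dz') + Q(z, dz') α(z; z')`, `α(z) = ∫ α(z; z') Q(z, dz')`. -/
noncomputable def acceptReject (Q : Kernel S S) [IsMarkovKernel Q] (α : S → S → ℝ≥0) :
    Kernel S S :=
  Kernel.withDensity Kernel.id (fun z _ => 1 - ∫⁻ z', α z z' ∂(Q z)) +
    Kernel.withDensity Q (fun z z' => (α z z' : ℝ≥0∞))

theorem isMarkovKernel_acceptReject (Q : Kernel S S) [IsMarkovKernel Q] (α : S → S → ℝ≥0)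
    (hα : Measurable (Function.uncurry α)) (h1 : ∀ z z', α z z' ≤ 1) :
    IsMarkovKernel (acceptReject Q α) := by
  have hα' : Measurable (Function.uncurry fun z z' => (α z z' : ℝ≥0∞)) :=
    measurable_coe_nnreal_ennreal.comp hα
  have hA : Measurable fun z => ∫⁻ z', (α z z' : ℝ≥0∞) ∂(Q z) := hα'.lintegral_kernel_prod_right
  have hr : Measurable (Function.uncurry
      fun (z : S) (_ : S) => 1 - ∫⁻ z', (α z z' : ℝ≥0∞) ∂(Q z)) :=
    (measurable_const.sub hA).comp measurable_fst
  refine ⟨fun z => ⟨?_⟩⟩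
  have hle : ∫⁻ z', (α z z' : ℝ≥0∞) ∂(Q z) ≤ 1 := by
    calc ∫⁻ z', (α z z' : ℝ≥0∞) ∂(Q z) ≤ ∫⁻ _, 1 ∂(Q z) :=
          lintegral_mono fun z' => by simpa using h1 z z'
      _ = 1 := by simp
  rw [acceptReject, _root_.add_apply, Measure.add_apply, Kernel.withDensity_apply' _ hr,
    Kernel.withDensity_apply' _ hα']
  simp only [Measure.restrict_univ, lintegral_const, measure_univ, mul_one]
  exact tsub_add_cancel_of_le hle

end Chain

/-- A target probability density `π` and a proposal transition density `q`, with respect to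
a common dominating measure on `X`. -/
structure Setup (X : Type*) [MeasurableSpace X] where
  /-- the dominating measure `dx` -/
  dom : Measure X
  sigmaFinite_dom : SigmaFinite dom
  /-- the target density -/
  p : X → ℝ≥0
  measurable_p : Measurable p
  lintegral_p : ∫⁻ x, p x ∂dom = 1
  /-- the proposal density `q(x, x')` -/
  q : X → X → ℝ≥0
  measurable_q : Measurable (Function.uncurry q)
  lintegral_q : ∀ x, ∫⁻ x', q x x' ∂dom = 1

attribute [instance] Setup.sigmaFinite_dom

/-- The average `(w_1 + ... + w_r) / r`. -/
noncomputable def avg {r : ℕ} (w : Fin r → ℝ≥0) : ℝ≥0 := (∑ i, w i) / r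

/-- The law of a finite random vector is exchangeable: invariant under all permutations of
the coordinates. -/
def Exchangeable {r : ℕ} (ν : Measure (Fin r → ℝ≥0)) : Prop :=
  ∀ σ : Equiv.Perm (Fin r), ν.map (fun w i => w (σ i)) = ν

/-- The joint law, given `x`, of the first `s` of `m` weights. -/
noncomputable def firstWeights {X : Type*} [MeasurableSpace X] {s m : ℕ} (h : s ≤ m)
    (κ : Kernel X (Fin m → ℝ≥0)) : Kernel X (Fin s → ℝ≥0) :=
  κ.map (fun w i => w (Fin.castLE h i))

instance {X : Type*} [MeasurableSpace X] {s m : ℕ} (h : s ≤ m)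
    (κ : Kernel X (Fin m → ℝ≥0)) [IsMarkovKernel κ] : IsMarkovKernel (firstWeights h κ) :=
  Kernel.IsMarkovKernel.map κ (by fun_prop)

namespace Setup

variable {X : Type*} [MeasurableSpace X] (M : Setup X)

/-- The target distribution `π(dx) = π(x) dx`. -/
noncomputable def target : Measure X := M.dom.withDensity (fun x => (M.p x : ℝ≥0∞))

/-- The proposal kernel `Q(x, dx') = q(x, x') dx'`. -/
noncomputable def proposal : Kernel X X :=
  Kernel.withDensity (Kernel.const X M.dom) (fun x x' => (M.q x x' : ℝ≥0∞))

instance : IsMarkovKernel M.proposal := by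
  refine ⟨fun x => ⟨?_⟩⟩
  have hq : Measurable (Function.uncurry fun x x' => (M.q x x' : ℝ≥0∞)) :=
    measurable_coe_nnreal_ennreal.comp M.measurable_q
  rw [proposal, Kernel.withDensity_apply' _ hq]
  simpa using M.lintegral_q x

/-- The Metropolis-Hastings ratio `r(x, x')`. -/
noncomputable def ratio (x x' : X) : ℝ≥0 := (M.p x' * M.q x' x) / (M.p x * M.q x x')

section Weights

variable {r : ℕ} (κ : Kernel X (Fin r → ℝ≥0))

open Classical in
/-- The acceptance probability `1 ∧ {r(x, x') w̄' / w̄}`, where `w̄` is the average of the weights;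
a proposal is accepted when the denominator `π(x) q(x, x') w̄` vanishes, which has probability
zero for the stationary chain. -/
noncomputable def accept (z z' : X × (Fin r → ℝ≥0)) : ℝ≥0 :=
  if M.p z.1 * M.q z.1 z'.1 * avg z.2 = 0 then 1
  else min 1 (M.ratio z.1 z'.1 * (avg z'.2 / avg z.2))

/-- The pseudo-marginal proposal `Q(x, dx') q_{x'}(dw')`. -/
noncomputable def pmProposal [IsMarkovKernel κ] :
    Kernel (X × (Fin r → ℝ≥0)) (X × (Fin r → ℝ≥0)) :=
  (M.proposal.compProd (Kernel.prodMkLeft X κ)).comap Prod.fst measurable_fst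

instance [IsMarkovKernel κ] : IsMarkovKernel (M.pmProposal κ) := by
  unfold pmProposal; infer_instance

/-- The pseudo-marginal Metropolis-Hastings kernel that uses the average of `r` weights with
conditional joint law `κ x = q_x(dw)`. -/
noncomputable def pmKernel [IsMarkovKernel κ] :
    Kernel (X × (Fin r → ℝ≥0)) (X × (Fin r → ℝ≥0)) :=
  acceptReject (M.pmProposal κ) M.accept

/-- The invariant distribution `π(dx) q_x(dw) w̄`. -/
noncomputable def pmTarget [IsMarkovKernel κ] : Measure (X × (Fin r → ℝ≥0)) :=
  (M.target.compProd κ).withDensity (fun z => (avg z.2 : ℝ≥0∞))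

theorem measurable_accept :
    Measurable (Function.uncurry (M.accept : X × (Fin r → ℝ≥0) → X × (Fin r → ℝ≥0) → ℝ≥0)) := by
  have hq1 : Measurable fun a : (X × (Fin r → ℝ≥0)) × (X × (Fin r → ℝ≥0)) => M.q a.1.1 a.2.1 :=
    M.measurable_q.comp (by fun_prop : Measurable fun
      a : (X × (Fin r → ℝ≥0)) × (X × (Fin r → ℝ≥0)) => (a.1.1, a.2.1))
  have hq2 : Measurable fun a : (X × (Fin r → ℝ≥0)) × (X × (Fin r → ℝ≥0)) => M.q a.2.1 a.1.1 :=
    M.measurable_q.comp (by fun_prop : Measurable fun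
      a : (X × (Fin r → ℝ≥0)) × (X × (Fin r → ℝ≥0)) => (a.2.1, a.1.1))
  have hp := M.measurable_p
  unfold Function.uncurry accept ratio avg
  refine Measurable.ite (measurableSet_eq_fun (by fun_prop) (by fun_prop)) (by fun_prop)
    (by fun_prop)

instance [IsMarkovKernel κ] : IsMarkovKernel (M.pmKernel κ) := by
  refine isMarkovKernel_acceptReject _ _ M.measurable_accept fun z z' => ?_
  unfold accept
  split_ifs
  · exact le_rfl
  · exact min_le_left _ _

/-- The asymptotic variance, for the pseudo-marginal chain started at stationarity, of a function
of the `x`-coordinate. -/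
noncomputable def pmAsympVar [IsMarkovKernel κ] (φ : X → ℝ) : ℝ≥0∞ :=
  asympVar (M.pmTarget κ) (M.pmKernel κ) (fun z => φ z.1)

/-- The limit that defines the asymptotic variance exists in `[0, ∞]`. -/
def HasAsympVar [IsMarkovKernel κ] (φ : X → ℝ) : Prop :=
  Tendsto (scaledVar (M.pmTarget κ) (M.pmKernel κ) (fun z => φ z.1)) atTop
    (𝓝 (M.pmAsympVar κ φ))

end Weights

end Setup

end PseudoMarginal

/-! For a reversible chain the variance of a sum of n terms is built from partial sums of
autocovariances. Hence (var + Var)/2 is the Cesàro limit of those partial sums, formally ⟨φ, (1 -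
P)⁻¹ φ⟩ with φ centred. This equals the supremum over g of 2⟨φ, g⟩ - ⟨g, (1 - P) g⟩, and ⟨g, (1 - P)
g⟩ is half of the energy E(g) = ∫ (g(z) - g(z'))². `tendsto_cesaro_autocovSum` proves this in [0, ∞]
from approximate solutions of the Poisson equation, without spectral theory, and
`asympVar_add_evariance` carries it over to chains. It then suffices to turn each test function g
for P_s into one for P_m that does at least as well once the factors s and m are included.

Take cyclic windows of s weights out of m, and let R_j be the average over window j divided by the
average of all weights. By exchangeability, reweighting the m-target by R_j and keeping window j
gives the s-target. So ĝ = m⁻¹ ∑ R_j g(window j) has the same pairing as g with functions of x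
(`integral_mul_shiftMean`). Cauchy–Schwarz over pairs of windows bounds (ĝ(z) - ĝ(z'))² by an
average with weights R_i(z) R_j(z'). Since s R_j ≤ m, the flow of accepted moves satisfies (s/m)
flow_m R_i R_j' ≤ flow_s (`flow_mul_shiftRatio_le`). Integration gives (s/m) E_m(ĝ) ≤ E_s(g), and
the test function (s/m) ĝ concludes (`mul_dirichletFunctional_le`). -/

namespace PseudoMarginal

/-! ### Cesàro means and limits along even and odd indices. -/

section Cesaro

theorem tendsto_cesaro_atTop_of_nonneg {u : ℕ → ℝ} (h0 : ∀ n, 0 ≤ u n)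
    (h : Tendsto u atTop atTop) :
    Tendsto (fun n : ℕ => (∑ j ∈ Finset.range n, u j) / n) atTop atTop := by
  rw [tendsto_atTop]
  intro K
  obtain ⟨N, hN⟩ := eventually_atTop.1 (tendsto_atTop.1 h (|K| + 1))
  obtain ⟨N', hN'⟩ := exists_nat_ge (N * (|K| + 1))
  filter_upwards [eventually_ge_atTop (max (max N N') 1)] with n hn
  have h1 : N ≤ n := by omega
  have h2 : (N' : ℝ) ≤ n := by exact_mod_cast (by omega : N' ≤ n)
  have h3 : (0 : ℝ) < n := by exact_mod_cast (by omega : 0 < n)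
  rw [le_div_iff₀ h3, ← Finset.sum_range_add_sum_Ico _ h1]
  have h4 : 0 ≤ ∑ j ∈ Finset.range N, u j := Finset.sum_nonneg fun j _ => h0 j
  have h5 : ((n - N : ℕ) : ℝ) * (|K| + 1) ≤ ∑ j ∈ Finset.Ico N n, u j := by
    have := Finset.card_nsmul_le_sum (Finset.Ico N n) u (|K| + 1)
      fun j hj => hN j (Finset.mem_Ico.1 hj).1
    rwa [nsmul_eq_mul, Nat.card_Ico] at this
  rw [Nat.cast_sub h1] at h5
  nlinarith [le_abs_self K]

theorem tendsto_atTop_of_even_odd {α : Type*} {l : Filter α} {u : ℕ → α}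
    (he : Tendsto (fun n => u (2 * n)) atTop l) (ho : Tendsto (fun n => u (2 * n + 1)) atTop l) :
    Tendsto u atTop l := by
  intro s hs
  obtain ⟨N, hN⟩ := eventually_atTop.1 (he hs)
  obtain ⟨N', hN'⟩ := eventually_atTop.1 (ho hs)
  refine (eventually_ge_atTop (2 * N + 2 * N' + 2)).mono fun n hn => ?_
  obtain ⟨k, rfl | rfl⟩ := n.even_or_odd'
  · exact hN k (by omega)
  · exact hN' k (by omega)

end Cesaro

/-! ### Variational formula for a symmetric contraction. -/

section Hilbert

variable {H : Type*} [NormedAddCommGroup H] [InnerProductSpace ℝ H]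

/-- The autocovariances `⟪φ, P^k φ⟫`. -/
noncomputable def autocov (P : H →ₗ[ℝ] H) (φ : H) (k : ℕ) : ℝ := inner ℝ φ ((P ^ k) φ)

/-- Partial sums of the autocovariances. -/
noncomputable def autocovSum (P : H →ₗ[ℝ] H) (φ : H) (n : ℕ) : ℝ :=
  ∑ k ∈ Finset.range n, autocov P φ k

/-- The functional whose supremum over `g` is `⟪φ, (1 - P)⁻¹ φ⟫`. -/
noncomputable def resolventForm (P : H →ₗ[ℝ] H) (φ g : H) : ℝ :=
  2 * inner ℝ φ g - inner ℝ g (g - P g)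

variable {P : H →ₗ[ℝ] H}

theorem inner_pow_pow (hs : P.IsSymmetric) (φ : H) (i j : ℕ) :
    inner ℝ ((P ^ i) φ) ((P ^ j) φ) = autocov P φ (i + j) := by
  rw [autocov, pow_add, Module.End.mul_apply, ← (hs.pow i) φ]

theorem abs_inner_apply_le (hc : ∀ x, ‖P x‖ ≤ ‖x‖) (x : H) : |inner ℝ x (P x)| ≤ ‖x‖ ^ 2 := by
  calc |inner ℝ x (P x)| ≤ ‖x‖ * ‖P x‖ := abs_real_inner_le_norm _ _
    _ ≤ ‖x‖ * ‖x‖ := by gcongr; exact hc x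
    _ = ‖x‖ ^ 2 := (sq _).symm

theorem inner_sub_apply_nonneg (hc : ∀ x, ‖P x‖ ≤ ‖x‖) (x : H) : 0 ≤ inner ℝ x (x - P x) := by
  rw [inner_sub_right, real_inner_self_eq_norm_sq]
  linarith [(abs_le.1 (abs_inner_apply_le hc x)).2]

/-- This is (1 + P)² ≤ 2 (1 + P), which also yields 1 + P ≥ 0. -/
theorem norm_add_apply_sq_le (hc : ∀ x, ‖P x‖ ≤ ‖x‖) (x : H) :
    ‖x + P x‖ ^ 2 ≤ 2 * inner ℝ x (x + P x) := by
  rw [norm_add_sq_real, inner_add_right, real_inner_self_eq_norm_sq]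
  nlinarith [hc x, norm_nonneg (P x)]

theorem apply_pow_apply (φ : H) (k : ℕ) : P ((P ^ k) φ) = (P ^ (k + 1)) φ := by
  rw [pow_succ', Module.End.mul_apply]

theorem autocov_even_add_odd (hs : P.IsSymmetric) (φ : H) (i : ℕ) :
    autocov P φ (2 * i) + autocov P φ (2 * i + 1) =
      inner ℝ ((P ^ i) φ) ((P ^ i) φ + P ((P ^ i) φ)) := by
  rw [inner_add_right, apply_pow_apply, inner_pow_pow hs, inner_pow_pow hs]
  congr 2 <;> ring

theorem autocov_even (hs : P.IsSymmetric) (φ : H) (i : ℕ) :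
    autocov P φ (2 * i) = ‖(P ^ i) φ‖ ^ 2 := by
  rw [← real_inner_self_eq_norm_sq, inner_pow_pow hs, two_mul]

theorem autocov_even_add_odd_nonneg (hs : P.IsSymmetric) (hc : ∀ x, ‖P x‖ ≤ ‖x‖) (φ : H) (i : ℕ) :
    0 ≤ autocov P φ (2 * i) + autocov P φ (2 * i + 1) := by
  rw [autocov_even_add_odd hs]
  nlinarith [norm_add_apply_sq_le hc ((P ^ i) φ), sq_nonneg ‖(P ^ i) φ + P ((P ^ i) φ)‖]

theorem autocov_even_add_two_mul_add (hs : P.IsSymmetric) (φ : H) (i : ℕ) :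
    autocov P φ (2 * i) + 2 * autocov P φ (2 * i + 1) + autocov P φ (2 * i + 2) =
      ‖(P ^ i) φ + P ((P ^ i) φ)‖ ^ 2 := by
  rw [norm_add_sq_real, apply_pow_apply, inner_pow_pow hs, ← autocov_even hs, ← autocov_even hs,
    show i + (i + 1) = 2 * i + 1 by ring, show 2 * (i + 1) = 2 * i + 2 by ring]

theorem abs_autocov_le (hc : ∀ x, ‖P x‖ ≤ ‖x‖) (φ : H) (k : ℕ) : |autocov P φ k| ≤ ‖φ‖ ^ 2 := by
  have h : ‖(P ^ k) φ‖ ≤ ‖φ‖ := by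
    induction k with
    | zero => simp
    | succ k ih => rw [← apply_pow_apply]; exact (hc _).trans ih
  calc |autocov P φ k| ≤ ‖φ‖ * ‖(P ^ k) φ‖ := abs_real_inner_le_norm _ _
    _ ≤ ‖φ‖ * ‖φ‖ := by gcongr
    _ = ‖φ‖ ^ 2 := (sq _).symm

/-- An approximate solution `v` of `v - P v = φ`. -/
noncomputable def approxPoisson (P : H →ₗ[ℝ] H) (φ : H) (N : ℕ) : H :=
  ∑ k ∈ Finset.range (2 * N), (P ^ k) φ + (1 / 2 : ℝ) • (P ^ (2 * N)) φ

/-- The residual of the approximate solution `approxPoisson`. -/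
noncomputable def poissonResidual (P : H →ₗ[ℝ] H) (φ : H) (N : ℕ) : H :=
  (1 / 2 : ℝ) • ((P ^ (2 * N)) φ + P ((P ^ (2 * N)) φ))

/-- The extra half term makes the residual a multiple of (1 + P) P^(2N) φ, which can tend to zero
even when -1 is an eigenvalue of P. -/
theorem approxPoisson_sub (φ : H) (N : ℕ) :
    approxPoisson P φ N - P (approxPoisson P φ N) = φ - poissonResidual P φ N := by
  have h : ∀ n, ∑ k ∈ Finset.range n, (P ^ k) φ - P (∑ k ∈ Finset.range n, (P ^ k) φ) =
      φ - (P ^ n) φ := by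
    intro n
    rw [map_sum, ← Finset.sum_sub_distrib]
    simp_rw [apply_pow_apply]
    rw [Finset.sum_range_sub']
    simp
  rw [approxPoisson, map_add, map_smul, add_sub_add_comm, h, poissonResidual]
  module

theorem inner_approxPoisson (φ : H) (N : ℕ) :
    inner ℝ φ (approxPoisson P φ N) =
      autocovSum P φ (2 * N) + autocov P φ (2 * N) / 2 := by
  rw [approxPoisson, inner_add_right, inner_sum, inner_smul_right, autocovSum]
  simp only [autocov]
  ring

/-- Consecutive terms group into a_{2i} + 2 a_{2i+1} + a_{2i+2} = ‖P^i φ + P^(i+1) φ‖², where a_k is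
`autocov P φ k`. -/
theorem inner_approxPoisson_residual_nonneg (hs : P.IsSymmetric) (hc : ∀ x, ‖P x‖ ≤ ‖x‖)
    (φ : H) (N : ℕ) : 0 ≤ inner ℝ (approxPoisson P φ N) (poissonResidual P φ N) := by
  have h1 : ∀ M, 0 ≤ ∑ k ∈ Finset.range (2 * M),
      (autocov P φ (k + 2 * N) + autocov P φ (k + 2 * N + 1)) := by
    intro M
    induction M with
    | zero => simp
    | succ M ih =>
      rw [show 2 * (M + 1) = 2 * M + 1 + 1 by ring, Finset.sum_range_succ, Finset.sum_range_succ]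
      have h := autocov_even_add_two_mul_add hs φ (M + N)
      have h' := sq_nonneg ‖(P ^ (M + N)) φ + P ((P ^ (M + N)) φ)‖
      rw [show 2 * M + 1 + 2 * N = 2 * (M + N) + 1 by ring,
        show 2 * M + 2 * N = 2 * (M + N) by ring]
      linarith
  have h2 : inner ℝ (approxPoisson P φ N) (poissonResidual P φ N) =
      (∑ k ∈ Finset.range (2 * N), (autocov P φ (k + 2 * N) + autocov P φ (k + 2 * N + 1))) / 2 +
      (autocov P φ (2 * (2 * N)) + autocov P φ (2 * (2 * N) + 1)) / 4 := by
    rw [approxPoisson, poissonResidual, inner_add_left, inner_smul_right, inner_smul_right,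
      inner_smul_left, sum_inner]
    simp only [inner_add_right, apply_pow_apply, inner_pow_pow hs]
    simp only [← add_assoc, ← two_mul]
    simp
    ring
  rw [h2]
  linarith [h1 N, autocov_even_add_odd_nonneg hs hc φ (2 * N)]

/-- The bound is an increment of the even partial sums, so the residual vanishes in the limit as
soon as these converge. -/
theorem norm_poissonResidual_sq_le (hs : P.IsSymmetric) (hc : ∀ x, ‖P x‖ ≤ ‖x‖) (φ : H) (N : ℕ) :
    ‖poissonResidual P φ N‖ ^ 2 ≤
      autocov P φ (2 * (2 * N)) + autocov P φ (2 * (2 * N) + 1) := by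
  rw [autocov_even_add_odd hs, poissonResidual, norm_smul, mul_pow]
  have h := norm_add_apply_sq_le hc ((P ^ (2 * N)) φ)
  have h' := sq_nonneg ‖(P ^ (2 * N)) φ + P ((P ^ (2 * N)) φ)‖
  norm_num
  linarith

theorem inner_approxPoisson_le_resolventForm (hs : P.IsSymmetric) (hc : ∀ x, ‖P x‖ ≤ ‖x‖)
    (φ : H) (N : ℕ) :
    inner ℝ φ (approxPoisson P φ N) ≤ resolventForm P φ (approxPoisson P φ N) := by
  rw [resolventForm, approxPoisson_sub, inner_sub_right, real_inner_comm φ]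
  linarith [inner_approxPoisson_residual_nonneg hs hc φ N]

/-- Expand 0 ≤ ⟨v - g, (1 - P)(v - g)⟩ with v the approximate solution, and drop the nonnegative
pairing of v with its residual. -/
theorem resolventForm_le (hs : P.IsSymmetric) (hc : ∀ x, ‖P x‖ ≤ ‖x‖) (φ g : H) (N : ℕ) :
    resolventForm P φ g ≤
      inner ℝ φ (approxPoisson P φ N) + 2 * inner ℝ (poissonResidual P φ N) g := by
  set v := approxPoisson P φ N with hv
  have h0 := inner_sub_apply_nonneg hc (v - g)
  have h1 : v - g - P (v - g) = (φ - poissonResidual P φ N) - (g - P g) := by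
    rw [← approxPoisson_sub, map_sub, ← hv]; abel
  have h2 : inner ℝ v (g - P g) = inner ℝ (φ - poissonResidual P φ N) g := by
    rw [← approxPoisson_sub, ← hv, inner_sub_right, inner_sub_left, hs v g]
  have h3 := inner_approxPoisson_residual_nonneg hs hc φ N
  rw [h1, inner_sub_left, inner_sub_right, h2, inner_sub_right v, inner_sub_right g,
    inner_sub_left _ _ g, inner_sub_right g φ] at h0
  rw [resolventForm]
  rw [← hv] at h3
  linarith [real_inner_comm v φ, real_inner_comm g φ, real_inner_comm g (poissonResidual P φ N)]

theorem autocovSum_even_monotone (hs : P.IsSymmetric) (hc : ∀ x, ‖P x‖ ≤ ‖x‖) (φ : H) :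
    Monotone fun N => autocovSum P φ (2 * N) := by
  refine monotone_nat_of_le_succ fun N => ?_
  rw [show 2 * (N + 1) = 2 * N + 1 + 1 by ring, autocovSum, autocovSum, Finset.sum_range_succ,
    Finset.sum_range_succ]
  linarith [autocov_even_add_odd_nonneg hs hc φ N]

theorem autocovSum_succ (φ : H) (n : ℕ) :
    autocovSum P φ (n + 1) = autocovSum P φ n + autocov P φ n := by
  rw [autocovSum, autocovSum, Finset.sum_range_succ]

/-- For a symmetric contraction `P`, the Cesàro means of the partial sums of the autocovariances
converge in `[0, ∞]` to the value of the variational problem defining `⟪φ, (1 - P)⁻¹ φ⟫`. -/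
theorem tendsto_cesaro_autocovSum (hs : P.IsSymmetric) (hc : ∀ x, ‖P x‖ ≤ ‖x‖) (φ : H) :
    Tendsto (fun n : ℕ => ENNReal.ofReal ((∑ j ∈ Finset.range n, autocovSum P φ (j + 1)) / n))
      atTop (𝓝 (⨆ g, ENNReal.ofReal (resolventForm P φ g))) := by
  have hmono := autocovSum_even_monotone hs hc φ
  have hev0 : ∀ N, 0 ≤ autocov P φ (2 * N) := fun N => by
    rw [autocov_even hs]; positivity
  have hle : ∀ N, ENNReal.ofReal (inner ℝ φ (approxPoisson P φ N)) ≤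
      ⨆ g, ENNReal.ofReal (resolventForm P φ g) := fun N =>
    (ENNReal.ofReal_le_ofReal (inner_approxPoisson_le_resolventForm hs hc φ N)).trans
      (le_iSup (fun g => ENNReal.ofReal (resolventForm P φ g)) _)
  -- The even partial sums increase, so they either diverge, and both sides are infinite, or
  -- converge to some L.
  rcases tendsto_atTop_of_monotone hmono with hinf | ⟨L, hL⟩
  · have htop : ⨆ g, ENNReal.ofReal (resolventForm P φ g) = ∞ := by
      refine top_unique (le_of_tendsto (ENNReal.tendsto_ofReal_nhds_top.2 hinf)
        (Eventually.of_forall fun N => le_trans ?_ (hle N)))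
      refine ENNReal.ofReal_le_ofReal ?_
      rw [inner_approxPoisson]
      linarith [hev0 N]
    rw [htop, ENNReal.tendsto_ofReal_nhds_top]
    have hodd : ∀ N, autocovSum P φ (2 * N) ≤ autocovSum P φ (2 * N + 1) := fun N => by
      rw [autocovSum_succ]; linarith [hev0 N]
    have hnn : ∀ n, 0 ≤ autocovSum P φ n := by
      intro n
      have h : ∀ N, 0 ≤ autocovSum P φ (2 * N) := fun N => by
        simpa [autocovSum] using hmono (Nat.zero_le N)
      obtain ⟨k, rfl | rfl⟩ := n.even_or_odd'
      · exact h k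
      · exact (h k).trans (hodd k)
    refine tendsto_cesaro_atTop_of_nonneg (u := fun j => autocovSum P φ (j + 1))
      (fun n => hnn _) ?_
    exact (tendsto_add_atTop_iff_nat 1).2
      (tendsto_atTop_of_even_odd hinf (tendsto_atTop_mono hodd hinf))
  -- The even autocovariances decrease to some c. The partial sums tend to L along even indices and
  -- to L + c along odd ones, so the Cesàro limit has to be L + c/2.
  · have hanti : Antitone fun N => autocov P φ (2 * N) := by
      refine antitone_nat_of_succ_le fun N => ?_
      rw [autocov_even hs, autocov_even hs, ← apply_pow_apply]
      gcongr
      exact hc _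
    obtain ⟨c, hcl⟩ : ∃ c, Tendsto (fun N => autocov P φ (2 * N)) atTop (𝓝 c) :=
      ⟨_, tendsto_atTop_ciInf hanti ⟨0, by rintro _ ⟨N, rfl⟩; exact hev0 N⟩⟩
    have hpair : Tendsto (fun N => autocov P φ (2 * N) + autocov P φ (2 * N + 1)) atTop (𝓝 0) := by
      have h := ((tendsto_add_atTop_iff_nat 1).2 hL).sub hL
      rw [sub_self] at h
      refine h.congr fun N => ?_
      rw [show 2 * (N + 1) = 2 * N + 1 + 1 by ring, autocovSum_succ, autocovSum_succ]
      ring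
    have ht : Tendsto (fun N => inner ℝ φ (approxPoisson P φ N)) atTop (𝓝 (L + c / 2)) := by
      simp_rw [inner_approxPoisson]
      exact hL.add (hcl.div_const 2)
    have hres : ∀ g, Tendsto (fun N => inner ℝ (poissonResidual P φ N) g) atTop (𝓝 0) := by
      intro g
      have h1 : Tendsto (fun N => ‖poissonResidual P φ N‖ ^ 2) atTop (𝓝 0) := by
        refine squeeze_zero (fun N => sq_nonneg _) (norm_poissonResidual_sq_le hs hc φ) ?_
        exact hpair.comp (tendsto_id.const_mul_atTop' (by norm_num : 0 < 2))
      have h2 : Tendsto (fun N => ‖poissonResidual P φ N‖) atTop (𝓝 0) := by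
        have := h1.sqrt
        simpa [Real.sqrt_sq (norm_nonneg _)] using this
      have h3 : Tendsto (fun N => ‖poissonResidual P φ N‖ * ‖g‖) atTop (𝓝 0) := by
        simpa using h2.mul_const ‖g‖
      exact squeeze_zero_norm (fun N => by simpa using abs_real_inner_le_norm _ g) h3
    have hsup : ⨆ g, ENNReal.ofReal (resolventForm P φ g) = ENNReal.ofReal (L + c / 2) := by
      refine le_antisymm (iSup_le fun g => ENNReal.ofReal_le_ofReal ?_) ?_
      · have h := ht.add ((hres g).const_mul 2)
        rw [mul_zero, add_zero] at h
        exact ge_of_tendsto h (Eventually.of_forall fun N => resolventForm_le hs hc φ g N)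
      · exact le_of_tendsto (ENNReal.tendsto_ofReal ht) (Eventually.of_forall hle)
    rw [hsup]
    refine ENNReal.tendsto_ofReal ?_
    have hw : Tendsto (fun n => autocovSum P φ n + autocov P φ n / 2) atTop (𝓝 (L + c / 2)) := by
      refine tendsto_atTop_of_even_odd (hL.add (hcl.div_const 2)) ?_
      have h := (hL.add (hcl.div_const 2)).add (hpair.div_const 2)
      rw [zero_div, add_zero] at h
      refine h.congr fun N => ?_
      rw [autocovSum_succ]
      ring
    have hinv : Tendsto (fun n : ℕ => ((n : ℝ))⁻¹) atTop (𝓝 0) := tendsto_inv_atTop_nhds_zero_nat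
    have hsn : Tendsto (fun n : ℕ => autocovSum P φ n * (n : ℝ)⁻¹) atTop (𝓝 0) := by
      have h1 := hw.mul hinv
      have h2 : Tendsto (fun n : ℕ => autocov P φ n / 2 * (n : ℝ)⁻¹) atTop (𝓝 0) := by
        have h3 : Tendsto (fun n : ℕ => ‖φ‖ ^ 2 * (n : ℝ)⁻¹) atTop (𝓝 0) := by
          simpa using hinv.const_mul (‖φ‖ ^ 2)
        refine squeeze_zero_norm (fun n => ?_) h3
        rw [norm_mul, norm_inv, Real.norm_natCast]
        gcongr
        rw [Real.norm_eq_abs, abs_div, abs_two]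
        linarith [abs_autocov_le hc φ n, abs_nonneg (autocov P φ n)]
      have h := h1.sub h2
      simp only [mul_zero, sub_zero] at h
      refine h.congr fun n => by ring
    -- Write S_{j+1} = (S_j + a_j/2) + a_j/2. The first part converges, and the remaining halves add
    -- up to S_n/2, negligible after division by n.
    have h := hw.cesaro.add (hsn.div_const 2)
    rw [zero_div, add_zero] at h
    refine h.congr fun n => ?_
    have h4 : autocovSum P φ n = ∑ j ∈ Finset.range n, autocov P φ j := rfl
    rw [h4, div_eq_inv_mul _ (n : ℝ), mul_comm _ (n : ℝ)⁻¹, mul_div_assoc, ← mul_add,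
      Finset.sum_div, ← Finset.sum_add_distrib]
    congr 1
    refine Finset.sum_congr rfl fun j _ => ?_
    rw [autocovSum_succ]
    ring

end Hilbert

/-! ### The Markov operator of a reversible kernel on L². -/

section Operator

/-- The operator `U† V` attached to two isometries. -/
noncomputable def correlationOp {H K : Type*} [NormedAddCommGroup H] [InnerProductSpace ℝ H]
    [CompleteSpace H] [NormedAddCommGroup K] [InnerProductSpace ℝ K] [CompleteSpace K]
    (U V : H →ₗᵢ[ℝ] K) : H →ₗ[ℝ] H :=
  (ContinuousLinearMap.adjoint U.toContinuousLinearMap ∘L V.toContinuousLinearMap).toLinearMap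

theorem inner_correlationOp {H K : Type*} [NormedAddCommGroup H] [InnerProductSpace ℝ H]
    [CompleteSpace H] [NormedAddCommGroup K] [InnerProductSpace ℝ K] [CompleteSpace K]
    (U V : H →ₗᵢ[ℝ] K) (f g : H) : inner ℝ f (correlationOp U V g) = inner ℝ (U f) (V g) :=
  ContinuousLinearMap.adjoint_inner_right U.toContinuousLinearMap f (V g)

theorem norm_correlationOp_le {H K : Type*} [NormedAddCommGroup H] [InnerProductSpace ℝ H]
    [CompleteSpace H] [NormedAddCommGroup K] [InnerProductSpace ℝ K] [CompleteSpace K]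
    (U V : H →ₗᵢ[ℝ] K) (f : H) : ‖correlationOp U V f‖ ≤ ‖f‖ := by
  have h1 : ‖correlationOp U V f‖ ^ 2 ≤ ‖correlationOp U V f‖ * ‖f‖ := by
    rw [← real_inner_self_eq_norm_sq, inner_correlationOp]
    simpa using real_inner_le_norm (U (correlationOp U V f)) (V f)
  nlinarith [norm_nonneg (correlationOp U V f), norm_nonneg f]

variable {S : Type*} [MeasurableSpace S]

/-- Detailed balance: the law of two consecutive states is symmetric. -/
def DetailedBalance (μ : Measure S) (P : Kernel S S) : Prop :=
  (μ ⊗ₘ P).map Prod.swap = μ ⊗ₘ P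

theorem DetailedBalance.measurePreserving_swap {μ : Measure S} {P : Kernel S S}
    (h : DetailedBalance μ P) : MeasurePreserving Prod.swap (μ ⊗ₘ P) (μ ⊗ₘ P) :=
  ⟨measurable_swap, h⟩

theorem integrable_mul_of_measurePreserving {Ω : Type*} [MeasurableSpace Ω] {μ : Measure S}
    {ν : Measure Ω} {a b : Ω → S} (ha : MeasurePreserving a ν μ) (hb : MeasurePreserving b ν μ)
    {f g : S → ℝ} (hf : MemLp f 2 μ) (hg : MemLp g 2 μ) :
    Integrable (fun ω => f (a ω) * g (b ω)) ν :=
  (hf.comp_measurePreserving ha).integrable_mul (hg.comp_measurePreserving hb)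

theorem integral_mul_self_comp {Ω : Type*} [MeasurableSpace Ω] {μ : Measure S}
    {ν : Measure Ω} {a : Ω → S} (ha : MeasurePreserving a ν μ) (f g : Lp ℝ 2 μ) :
    ∫ ω, f (a ω) * g (a ω) ∂ν = inner ℝ f g := by
  have h := integral_map (μ := ν) ha.measurable.aemeasurable (f := fun x => f x * g x)
    ((Lp.stronglyMeasurable f).mul (Lp.stronglyMeasurable g)).aestronglyMeasurable
  rw [ha.map_eq] at h
  rw [← h, L2.inner_def]
  simp [mul_comm]

variable {μ : Measure S} [IsProbabilityMeasure μ] {P : Kernel S S} [IsMarkovKernel P]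

theorem measurePreserving_fst_compProd : MeasurePreserving Prod.fst (μ ⊗ₘ P) μ :=
  ⟨measurable_fst, Measure.fst_compProd μ P⟩

theorem DetailedBalance.measurePreserving_snd (h : DetailedBalance μ P) :
    MeasurePreserving Prod.snd (μ ⊗ₘ P) μ :=
  measurePreserving_fst_compProd.comp h.measurePreserving_swap

theorem DetailedBalance.lintegral_apply (h : DetailedBalance μ P) {A : Set S}
    (hA : MeasurableSet A) : ∫⁻ x, P x A ∂μ = μ A := by
  rw [← h.measurePreserving_snd.measure_preimage hA.nullMeasurableSet,
    Measure.compProd_apply (measurable_snd hA)]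
  rfl

/-- The Markov operator on `L²(μ)` of a kernel in detailed balance with `μ`. -/
noncomputable def markovOp (h : DetailedBalance μ P) : Lp ℝ 2 μ →ₗ[ℝ] Lp ℝ 2 μ :=
  correlationOp
    (Lp.compMeasurePreservingₗᵢ ℝ Prod.fst (measurePreserving_fst_compProd (μ := μ) (P := P)))
    (Lp.compMeasurePreservingₗᵢ ℝ Prod.snd h.measurePreserving_snd)

theorem inner_markovOp (h : DetailedBalance μ P) (f g : Lp ℝ 2 μ) :
    inner ℝ f (markovOp h g) = ∫ z, f z.1 * g z.2 ∂(μ ⊗ₘ P) := by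
  rw [markovOp, inner_correlationOp, L2.inner_def]
  refine integral_congr_ae ?_
  filter_upwards [Lp.coeFn_compMeasurePreserving f (measurePreserving_fst_compProd (P := P)),
    Lp.coeFn_compMeasurePreserving g h.measurePreserving_snd] with z h2 h3
  rw [Lp.compMeasurePreservingₗᵢ_apply_coe, Lp.compMeasurePreservingₗᵢ_apply_coe]
  erw [h2, h3]
  simp [mul_comm]

theorem markovOp_isSymmetric (h : DetailedBalance μ P) : (markovOp h).IsSymmetric := by
  intro f g
  rw [real_inner_comm, inner_markovOp, inner_markovOp]
  rw [← h.measurePreserving_swap.integral_comp MeasurableEquiv.prodComm.measurableEmbedding]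
  simp [mul_comm]

theorem norm_markovOp_le (h : DetailedBalance μ P) (f : Lp ℝ 2 μ) : ‖markovOp h f‖ ≤ ‖f‖ :=
  norm_correlationOp_le _ _ f

/-- Links the operator, defined through an adjoint, to integration against the kernel, by testing on
indicators; the Markov property needs this form. -/
theorem markovOp_ae_eq (h : DetailedBalance μ P) (g : Lp ℝ 2 μ) :
    markovOp h g =ᵐ[μ] fun x => ∫ y, g y ∂(P x) := by
  have hint : Integrable (fun z : S × S => g z.2) (μ ⊗ₘ P) :=
    h.measurePreserving_snd.integrable_comp_of_integrable ((Lp.memLp g).integrable one_le_two)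
  have hint' : Integrable (fun x => ∫ y, g y ∂(P x)) μ := by
    simpa using Integrable.integral_compProd (hint : Integrable _ ((_ ⊗ₖ _) ()))
  refine Integrable.ae_eq_of_forall_setIntegral_eq _ _
    ((Lp.memLp _).integrable one_le_two) hint' fun A hA hA' => ?_
  have hi := integrable_mul_of_measurePreserving (measurePreserving_fst_compProd (P := P))
    h.measurePreserving_snd (Lp.memLp (indicatorConstLp 2 hA hA'.ne (1 : ℝ))) (Lp.memLp g)
  rw [← L2.inner_indicatorConstLp_one hA hA'.ne, inner_markovOp, Measure.integral_compProd hi,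
    ← integral_indicator hA]
  refine integral_congr_ae ?_
  filter_upwards [indicatorConstLp_coeFn (p := 2) (hs := hA) (hμs := hA'.ne) (c := (1 : ℝ))]
    with x hx
  simp only [hx, integral_const_mul]
  by_cases hxA : x ∈ A <;> simp [hxA]

theorem two_mul_inner_sub_markovOp (h : DetailedBalance μ P) (g : Lp ℝ 2 μ) :
    2 * inner ℝ g (g - markovOp h g) = ∫ z, (g z.1 - g z.2) ^ 2 ∂(μ ⊗ₘ P) := by
  have hg := Lp.memLp g
  have hf := measurePreserving_fst_compProd (μ := μ) (P := P)
  have hs := h.measurePreserving_snd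
  have h12 := integrable_mul_of_measurePreserving hf hs hg hg
  have h11 := integrable_mul_of_measurePreserving hf hf hg hg
  have h22 := integrable_mul_of_measurePreserving hs hs hg hg
  have e3 : ∀ z : S × S, (g z.1 - g z.2) ^ 2 =
      g z.1 * g z.1 + g z.2 * g z.2 - 2 * (g z.1 * g z.2) := fun z => by ring
  simp_rw [e3]
  rw [integral_sub (by exact h11.add h22) (h12.const_mul 2), integral_add h11 h22,
    integral_const_mul, integral_mul_self_comp hf, integral_mul_self_comp hs, inner_sub_right,
    inner_markovOp]
  ring

end Operator

/-! ### Stationarity and covariances of the chain. -/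

section ChainLaw

variable {S : Type*} [MeasurableSpace S] {μ : Measure S} {P : Kernel S S} [IsMarkovKernel P]

theorem chainLaw_eq_trajMeasure : chainLaw μ P = Kernel.trajMeasure (X := fun _ : ℕ => S) μ
    (fun n => P.comap (fun h => h ⟨n, Finset.mem_Iic.2 le_rfl⟩) (measurable_pi_apply _)) := by
  rw [chainLaw, Kernel.trajMeasure]
  congr 1

theorem chainLaw_map_zero : (chainLaw μ P).map (fun ω => ω 0) = μ := by
  have h : (chainLaw μ P).map (Preorder.frestrictLe 0) =
      μ.map (fun z (_ : Finset.Iic (0 : ℕ)) => z) := by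
    rw [chainLaw]
    erw [Measure.map_comp _ _ (by fun_prop), Kernel.traj_map_frestrictLe, Kernel.partialTraj_self,
      Measure.id_comp]
  have h2 : (fun ω : ℕ → S => ω 0) = (fun h : Finset.Iic (0 : ℕ) → S => h ⟨0, by simp⟩) ∘
      (Preorder.frestrictLe 0 : (ℕ → S) → _) := rfl
  rw [h2, ← Measure.map_map (by fun_prop) (by fun_prop), h,
    Measure.map_map (by fun_prop) (by fun_prop)]
  exact Measure.map_id

variable [IsProbabilityMeasure μ]

instance : IsProbabilityMeasure (chainLaw μ P) := by
  rw [chainLaw_eq_trajMeasure]; infer_instance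

theorem chainLaw_map_frestrictLe_compProd (n : ℕ) :
    ((chainLaw μ P).map (Preorder.frestrictLe n)) ⊗ₘ
      (P.comap (fun h : (i : Finset.Iic n) → S => h ⟨n, Finset.mem_Iic.2 le_rfl⟩)
        (measurable_pi_apply _)) =
      (chainLaw μ P).map (fun ω => (Preorder.frestrictLe n ω, ω (n + 1))) := by
  rw [chainLaw_eq_trajMeasure]
  exact Kernel.map_frestrictLe_trajMeasure_compProd_eq_map_trajMeasure

theorem DetailedBalance.measurePreserving_eval (h : DetailedBalance μ P) (n : ℕ) :
    MeasurePreserving (fun ω : ℕ → S => ω n) (chainLaw μ P) μ := by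
  refine ⟨measurable_pi_apply n, ?_⟩
  induction n with
  | zero => exact chainLaw_map_zero
  | succ n ih =>
    have h1 : (fun ω : ℕ → S => ω (n + 1)) = Prod.snd ∘
      (fun ω : ℕ → S => ((Preorder.frestrictLe n ω : (i : Finset.Iic n) → S), ω (n + 1))) := rfl
    rw [h1, ← Measure.map_map measurable_snd (by fun_prop), ← chainLaw_map_frestrictLe_compProd]
    ext A hA
    rw [Measure.map_apply measurable_snd hA, Measure.compProd_apply (measurable_snd hA),
      lintegral_map (Kernel.measurable_kernel_prodMk_left (measurable_snd hA)) (by fun_prop),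
      ← h.lintegral_apply hA]
    conv_rhs => rw [← ih]
    rw [lintegral_map (P.measurable_coe hA) (by fun_prop)]
    rfl

/-- Markov property: condition on the path up to time n, which determines ω i because i ≤ n. -/
theorem integral_mul_eval_succ (h : DetailedBalance μ P) (f g : Lp ℝ 2 μ) {i n : ℕ} (hi : i ≤ n) :
    ∫ ω, f (ω i) * g (ω (n + 1)) ∂(chainLaw μ P) =
      ∫ ω, f (ω i) * (markovOp h g) (ω n) ∂(chainLaw μ P) := by
  have hf := Lp.stronglyMeasurable f
  have hg := Lp.stronglyMeasurable g
  have hmap : Measurable (fun ω : ℕ → S =>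
      ((Preorder.frestrictLe n ω : (i : Finset.Iic n) → S), ω (n + 1))) := by fun_prop
  have hF : StronglyMeasurable (fun z : ((i : Finset.Iic n) → S) × S =>
      f (z.1 ⟨i, Finset.mem_Iic.2 hi⟩) * g z.2) :=
    (hf.comp_measurable (by fun_prop)).mul (hg.comp_measurable measurable_snd)
  have hint : Integrable (fun ω : ℕ → S => f (ω i) * g (ω (n + 1))) (chainLaw μ P) :=
    integrable_mul_of_measurePreserving (h.measurePreserving_eval i)
      (h.measurePreserving_eval (n + 1)) (Lp.memLp f) (Lp.memLp g)
  have e1 : ∫ ω, f (ω i) * g (ω (n + 1)) ∂(chainLaw μ P) =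
      ∫ z, f (z.1 ⟨i, Finset.mem_Iic.2 hi⟩) * g z.2 ∂((chainLaw μ P).map (fun ω : ℕ → S =>
        ((Preorder.frestrictLe n ω : (i : Finset.Iic n) → S), ω (n + 1)))) := by
    rw [integral_map hmap.aemeasurable hF.aestronglyMeasurable]
    rfl
  have hint2 : Integrable (fun z : ((i : Finset.Iic n) → S) × S =>
      f (z.1 ⟨i, Finset.mem_Iic.2 hi⟩) * g z.2) ((chainLaw μ P).map (fun ω : ℕ → S =>
        ((Preorder.frestrictLe n ω : (i : Finset.Iic n) → S), ω (n + 1)))) :=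
    (integrable_map_measure hF.aestronglyMeasurable hmap.aemeasurable).2 hint
  rw [e1]
  rw [← chainLaw_map_frestrictLe_compProd] at hint2 ⊢
  have hm2 : StronglyMeasurable fun x : (i : Finset.Iic n) → S =>
      ∫ y, g y ∂(P (x ⟨n, Finset.mem_Iic.2 le_rfl⟩)) :=
    (StronglyMeasurable.integral_kernel hg).comp_measurable (by fun_prop)
  rw [Measure.integral_compProd hint2]
  simp only [integral_const_mul, Kernel.comap_apply]
  rw [integral_map (by fun_prop)]
  · refine integral_congr_ae ?_
    filter_upwards [(h.measurePreserving_eval n).quasiMeasurePreserving.ae (markovOp_ae_eq h g)]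
      with ω hω
    rw [hω]
    rfl
  · exact ((hf.comp_measurable (measurable_pi_apply _)).mul hm2).aestronglyMeasurable

theorem integral_mul_eval_add (h : DetailedBalance μ P) (f g : Lp ℝ 2 μ) (i k : ℕ) :
    ∫ ω, f (ω i) * g (ω (i + k)) ∂(chainLaw μ P) = inner ℝ f ((markovOp h ^ k) g) := by
  induction k generalizing g with
  | zero => simpa using integral_mul_self_comp (h.measurePreserving_eval i) f g
  | succ k ih =>
    rw [← add_assoc, integral_mul_eval_succ h f g (Nat.le_add_right i k), ih, pow_succ,
      Module.End.mul_apply]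

/-- Passing from n to n + 1 adds 2(a_1 + ... + a_n) + a_0, that is, twice the partial sum up to a_n
minus a_0. -/
theorem integral_sum_sq (h : DetailedBalance μ P) (f : Lp ℝ 2 μ) (n : ℕ) :
    ∫ ω, (∑ k ∈ Finset.Icc 1 n, f (ω k)) ^ 2 ∂(chainLaw μ P) =
      ∑ j ∈ Finset.range n, (2 * autocovSum (markovOp h) f (j + 1) - autocov (markovOp h) f 0) := by
  have hL : ∀ k, MemLp (fun ω : ℕ → S => f (ω k)) 2 (chainLaw μ P) := fun k =>
    (Lp.memLp f).comp_measurePreserving (h.measurePreserving_eval k)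
  induction n with
  | zero => simp
  | succ n ih =>
    have hS : MemLp (fun ω : ℕ → S => ∑ k ∈ Finset.Icc 1 n, f (ω k)) 2 (chainLaw μ P) :=
      memLp_finsetSum _ fun k _ => hL k
    have e1 : ∀ ω : ℕ → S, (∑ k ∈ Finset.Icc 1 (n + 1), f (ω k)) ^ 2 =
        (∑ k ∈ Finset.Icc 1 n, f (ω k)) ^ 2 +
          (2 * ∑ k ∈ Finset.Icc 1 n, f (ω k) * f (ω (n + 1)) + f (ω (n + 1)) * f (ω (n + 1))) := by
      intro ω
      rw [Finset.sum_Icc_succ_top (by omega), ← Finset.sum_mul]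
      ring
    have hI : ∀ k l, Integrable (fun ω : ℕ → S => f (ω k) * f (ω l)) (chainLaw μ P) := fun k l =>
      (hL k).integrable_mul (hL l)
    simp_rw [e1]
    rw [integral_add hS.integrable_sq
        (by exact ((integrable_finsetSum _ fun k _ => hI k _).const_mul 2).add (hI _ _)),
      integral_add (by exact (integrable_finsetSum _ fun k _ => hI k _).const_mul 2) (hI _ _),
      integral_const_mul, integral_finsetSum _ fun k _ => hI k _, ih, Finset.sum_range_succ]
    congr 1
    have e2 : ∑ k ∈ Finset.Icc 1 n, ∫ ω, f (ω k) * f (ω (n + 1)) ∂(chainLaw μ P) =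
        ∑ j ∈ Finset.range n, autocov (markovOp h) f (j + 1) := by
      refine Finset.sum_bij' (fun k _ => n - k) (fun j _ => n - j) ?_ ?_ ?_ ?_ ?_
      · intro k hk; simp only [Finset.mem_Icc, Finset.mem_range] at *; omega
      · intro k hk; simp only [Finset.mem_Icc, Finset.mem_range] at *; omega
      · intro k hk; have := Finset.mem_Icc.1 hk; omega
      · intro k hk; have := Finset.mem_range.1 hk; omega
      · intro k hk
        have hk' : n + 1 = k + (n - k + 1) := by simp only [Finset.mem_Icc] at hk; omega
        rw [autocov, ← integral_mul_eval_add h f f k, ← hk']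
    have e3 : ∫ ω, f (ω (n + 1)) * f (ω (n + 1)) ∂(chainLaw μ P) = autocov (markovOp h) f 0 := by
      rw [autocov, ← integral_mul_eval_add h f f (n + 1) 0, add_zero]
    rw [e2, e3, autocovSum, Finset.sum_range_succ']
    ring

end ChainLaw

/-! ### The asymptotic variance as a supremum. -/

section AsymptoticVariance

variable {S : Type*} [MeasurableSpace S]

/-- The functional of the variational formula for the asymptotic variance of `f`. -/
noncomputable def dirichletFunctional (μ : Measure S) (P : Kernel S S) (f g : S → ℝ) : ℝ :=
  2 * ∫ x, (f x - ∫ y, f y ∂μ) * g x ∂μ - (1 / 2) * ∫ z, (g z.1 - g z.2) ^ 2 ∂(μ ⊗ₘ P)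

variable {μ : Measure S} [IsProbabilityMeasure μ] {P : Kernel S S} [IsMarkovKernel P]

/-- The centred function `f - μ f` as an element of `L²(μ)`. -/
noncomputable def centred {f : S → ℝ} (hf : MemLp f 2 μ) : Lp ℝ 2 μ :=
  (hf.sub (memLp_const (∫ x, f x ∂μ))).toLp _

theorem centred_ae_eq {f : S → ℝ} (hf : MemLp f 2 μ) :
    centred hf =ᵐ[μ] fun x => f x - ∫ y, f y ∂μ :=
  MemLp.coeFn_toLp _

theorem integral_centred {f : S → ℝ} (hf : MemLp f 2 μ) : ∫ x, centred hf x ∂μ = 0 := by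
  rw [integral_congr_ae (centred_ae_eq hf),
    integral_sub (hf.integrable one_le_two) (integrable_const _)]
  simp

theorem inner_centred_self {f : S → ℝ} (hf : MemLp f 2 μ) :
    inner ℝ (centred hf) (centred hf) = variance f μ := by
  rw [variance_eq_integral hf.aestronglyMeasurable.aemeasurable, L2.inner_def]
  refine integral_congr_ae ?_
  filter_upwards [centred_ae_eq hf] with x hx
  rw [hx]
  simp [sq]

theorem variance_sum_eval (h : DetailedBalance μ P) {f : S → ℝ} (hf : MemLp f 2 μ) (n : ℕ) :
    variance (fun ω : ℕ → S => ∑ k ∈ Finset.Icc 1 n, f (ω k)) (chainLaw μ P) =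
      ∑ j ∈ Finset.range n, (2 * autocovSum (markovOp h) (centred hf) (j + 1) - variance f μ) := by
  have hL : ∀ k, MemLp (fun ω : ℕ → S => centred hf (ω k)) 2 (chainLaw μ P) := fun k =>
    (Lp.memLp _).comp_measurePreserving (h.measurePreserving_eval k)
  have hS : MemLp (fun ω : ℕ → S => ∑ k ∈ Finset.Icc 1 n, centred hf (ω k)) 2 (chainLaw μ P) :=
    memLp_finsetSum _ fun k _ => hL k
  have e1 : (fun ω : ℕ → S => ∑ k ∈ Finset.Icc 1 n, f (ω k)) =ᵐ[chainLaw μ P]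
      fun ω => ∑ k ∈ Finset.Icc 1 n, centred hf (ω k) + n * ∫ y, f y ∂μ := by
    have : ∀ᵐ ω ∂(chainLaw μ P), ∀ k : ℕ, centred hf (ω k) = f (ω k) - ∫ y, f y ∂μ :=
      ae_all_iff.2 fun k =>
        (h.measurePreserving_eval k).quasiMeasurePreserving.ae (centred_ae_eq hf)
    filter_upwards [this] with ω hω
    simp [hω]
  have e2 : ∫ ω, ∑ k ∈ Finset.Icc 1 n, centred hf (ω k) ∂(chainLaw μ P) = 0 := by
    rw [integral_finsetSum _ fun k _ => (hL k).integrable one_le_two]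
    refine Finset.sum_eq_zero fun k _ => ?_
    have h1 := integral_map (μ := chainLaw μ P) (measurable_pi_apply k).aemeasurable
      (f := centred hf) (Lp.stronglyMeasurable _).aestronglyMeasurable
    rw [(h.measurePreserving_eval k).map_eq] at h1
    rw [← h1, integral_centred]
  rw [variance_congr e1, variance_add_const hS.aestronglyMeasurable,
    variance_of_integral_eq_zero hS.aestronglyMeasurable.aemeasurable e2]
  have e3 := integral_sum_sq h (centred hf) n
  have e4 : autocov (markovOp h) (centred hf) 0 = variance f μ := by
    rw [← inner_centred_self hf]; simp [autocov]
  rw [e4] at e3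
  exact e3

/-- Adding the variance cancels the -a_0 in each increment and leaves exactly twice a Cesàro mean;
hence the form of the main inequality. -/
theorem scaledVar_add_evariance (h : DetailedBalance μ P) {f : S → ℝ} (hf : MemLp f 2 μ) {n : ℕ}
    (hn : 0 < n) : scaledVar μ P f n + evariance f μ = 2 * ENNReal.ofReal
      ((∑ j ∈ Finset.range n, autocovSum (markovOp h) (centred hf) (j + 1)) / n) := by
  have hL : ∀ k, MemLp (fun ω : ℕ → S => f (ω k)) 2 (chainLaw μ P) := fun k =>
    hf.comp_measurePreserving (h.measurePreserving_eval k)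
  have hS : MemLp (fun ω : ℕ → S => ∑ k ∈ Finset.Icc 1 n, f (ω k)) 2 (chainLaw μ P) :=
    memLp_finsetSum _ fun k _ => hL k
  have hn' : (n : ℝ) ≠ 0 := by positivity
  have two : ∀ t : ℝ, 2 * ENNReal.ofReal t = ENNReal.ofReal (2 * t) := fun t => by
    rw [ENNReal.ofReal_mul (by norm_num), ENNReal.ofReal_ofNat]
  rw [scaledVar, ← (hS.const_mul _).ofReal_variance_eq, ← hf.ofReal_variance_eq,
    ← ENNReal.ofReal_add (variance_nonneg _ _) (variance_nonneg _ _), variance_const_mul,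
    variance_sum_eval h hf, 
    two]
  congr 1
  rw [inv_pow, Real.sq_sqrt (by positivity), Finset.sum_sub_distrib, ← Finset.mul_sum]
  simp
  field_simp
  ring

theorem resolventForm_toLp (h : DetailedBalance μ P) {f g : S → ℝ} (hf : MemLp f 2 μ)
    (hg : MemLp g 2 μ) :
    resolventForm (markovOp h) (centred hf) (hg.toLp g) = dirichletFunctional μ P f g := by
  have e1 : inner ℝ (centred hf) (hg.toLp g) = ∫ x, (f x - ∫ y, f y ∂μ) * g x ∂μ := by
    rw [L2.inner_def]
    refine integral_congr_ae ?_
    filter_upwards [centred_ae_eq hf, hg.coeFn_toLp] with x h1 h2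
    rw [h1, h2]
    simp [mul_comm]
  have e2 : ∫ z, (hg.toLp g z.1 - hg.toLp g z.2) ^ 2 ∂(μ ⊗ₘ P) =
      ∫ z, (g z.1 - g z.2) ^ 2 ∂(μ ⊗ₘ P) := by
    refine integral_congr_ae ?_
    filter_upwards [(measurePreserving_fst_compProd (P := P)).quasiMeasurePreserving.ae
      hg.coeFn_toLp,
      h.measurePreserving_snd.quasiMeasurePreserving.ae hg.coeFn_toLp] with z h1 h2
    rw [h1, h2]
  rw [resolventForm, dirichletFunctional, e1, ← e2, ← two_mul_inner_sub_markovOp h]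
  ring

/-- Test functions are required to be measurable, not only a.e. measurable: they are later
integrated against `refMeasure`, for which sets null under the invariant law need not be null. -/
theorem iSup_resolventForm (h : DetailedBalance μ P) {f : S → ℝ} (hf : MemLp f 2 μ) :
    ⨆ g, ENNReal.ofReal (resolventForm (markovOp h) (centred hf) g) =
      ⨆ (g : S → ℝ) (_ : Measurable g) (_ : MemLp g 2 μ), ENNReal.ofReal (dirichletFunctional μ P f g) := by
  refine le_antisymm (iSup_le fun g => ?_) (iSup₂_le fun g _ => iSup_le fun hg => ?_)
  · refine le_iSup₂_of_le (g : S → ℝ) (Lp.stronglyMeasurable g).measurable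
      (le_iSup_of_le (Lp.memLp g) ?_)
    rw [← resolventForm_toLp h hf (Lp.memLp g), Lp.toLp_coeFn]
  · rw [← resolventForm_toLp h hf hg]
    exact le_iSup (fun g => ENNReal.ofReal (resolventForm (markovOp h) (centred hf) g)) _

theorem tendsto_scaledVar_add_evariance (h : DetailedBalance μ P) {f : S → ℝ}
    (hf : MemLp f 2 μ) :
    Tendsto (fun n => scaledVar μ P f n + evariance f μ) atTop
      (𝓝 (2 * ⨆ (g : S → ℝ) (_ : Measurable g) (_ : MemLp g 2 μ), ENNReal.ofReal (dirichletFunctional μ P f g))) := by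
  rw [← iSup_resolventForm h hf]
  refine (ENNReal.Tendsto.const_mul (tendsto_cesaro_autocovSum (markovOp_isSymmetric h)
    (norm_markovOp_le h) (centred hf)) (Or.inr ENNReal.ofNat_ne_top)).congr' ?_
  filter_upwards [eventually_gt_atTop 0] with n hn
  rw [scaledVar_add_evariance h hf hn]

/-- For a reversible chain the limit defining the asymptotic variance exists. -/
theorem tendsto_scaledVar (h : DetailedBalance μ P) {f : S → ℝ} (hf : MemLp f 2 μ) :
    Tendsto (scaledVar μ P f) atTop (𝓝 (asympVar μ P f)) := by
  have hfin : evariance f μ ≠ ∞ := (evariance_lt_top hf).ne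
  have h1 := ENNReal.Tendsto.sub (tendsto_scaledVar_add_evariance h hf)
    (tendsto_const_nhds (x := evariance f μ)) (Or.inr hfin)
  simp only [ENNReal.add_sub_cancel_right hfin] at h1
  -- `limUnder` has a junk value unless some limit exists; subtracting the finite variance exhibits
  -- one.
  exact tendsto_nhds_limUnder ⟨_, h1⟩

/-- Variational formula for the asymptotic variance of a reversible chain. -/
theorem asympVar_add_evariance (h : DetailedBalance μ P) {f : S → ℝ} (hf : MemLp f 2 μ) :
    asympVar μ P f + evariance f μ =
      2 * ⨆ (g : S → ℝ) (_ : Measurable g) (_ : MemLp g 2 μ), ENNReal.ofReal (dirichletFunctional μ P f g) :=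
  tendsto_nhds_unique ((tendsto_scaledVar h hf).add tendsto_const_nhds)
    (tendsto_scaledVar_add_evariance h hf)

end AsymptoticVariance

/-! ### Reversibility of the pseudo-marginal kernel. -/

theorem lintegral_acceptReject {S : Type*} [MeasurableSpace S] (Q : Kernel S S) [IsMarkovKernel Q]
    {α : S → S → ℝ≥0} (hα : Measurable (Function.uncurry α)) {F : S → ℝ≥0∞} (hF : Measurable F)
    (z : S) : ∫⁻ z', F z' ∂(acceptReject Q α z) =
      (1 - ∫⁻ z', α z z' ∂(Q z)) * F z + ∫⁻ z', α z z' * F z' ∂(Q z) := by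
  have hα' : Measurable (Function.uncurry fun z z' => (α z z' : ℝ≥0∞)) :=
    measurable_coe_nnreal_ennreal.comp hα
  have hr : Measurable (Function.uncurry
      fun (z : S) (_ : S) => 1 - ∫⁻ z', (α z z' : ℝ≥0∞) ∂(Q z)) :=
    (measurable_const.sub hα'.lintegral_kernel_prod_right).comp measurable_fst
  rw [acceptReject, _root_.add_apply, lintegral_add_measure,
    Kernel.lintegral_withDensity _ hr _ hF, Kernel.lintegral_withDensity _ hα' _ hF, Kernel.id_apply,
    lintegral_dirac' z (f := fun b => (1 - ∫⁻ z', (α z z' : ℝ≥0∞) ∂(Q z)) * F b) (by fun_prop)]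

theorem lintegral_withDensity_compProd {X W : Type*} [MeasurableSpace X] [MeasurableSpace W]
    (ν : Measure X) [SFinite ν] (κ : Kernel X W) [IsSFiniteKernel κ] {p : X → ℝ≥0}
    (hp : Measurable p) {F : X × W → ℝ≥0∞} (hF : Measurable F) :
    ∫⁻ z, F z ∂((ν.withDensity fun x => (p x : ℝ≥0∞)) ⊗ₘ κ) = ∫⁻ z, p z.1 * F z ∂(ν ⊗ₘ κ) := by
  rw [Measure.lintegral_compProd hF, Measure.lintegral_compProd (by fun_prop),
    lintegral_withDensity_eq_lintegral_mul _ (by fun_prop) hF.lintegral_kernel_prod_right']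
  refine lintegral_congr fun x => ?_
  exact (lintegral_const_mul _ (hF.comp measurable_prodMk_left)).symm

namespace Setup

variable {X : Type*} [MeasurableSpace X] (M : Setup X) {r : ℕ} (κ : Kernel X (Fin r → ℝ≥0))

instance : IsProbabilityMeasure M.target :=
  ⟨by rw [target, withDensity_apply _ MeasurableSet.univ, Measure.restrict_univ, M.lintegral_p]⟩

theorem measurable_avg : Measurable (avg : (Fin r → ℝ≥0) → ℝ≥0) := by
  unfold avg; fun_prop

/-- The reference measure `dx q_x(dw)` on the extended state space. -/
noncomputable def refMeasure : Measure (X × (Fin r → ℝ≥0)) := M.dom ⊗ₘ κ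

instance [IsMarkovKernel κ] : SFinite (M.refMeasure κ) := by
  unfold refMeasure; infer_instance

/-- The density `π(x) w̄` of the invariant distribution. -/
noncomputable def pmDensity (z : X × (Fin r → ℝ≥0)) : ℝ≥0 := M.p z.1 * avg z.2

/-- The stationary flow density of accepted moves. -/
noncomputable def flow (y : (X × (Fin r → ℝ≥0)) × (X × (Fin r → ℝ≥0))) : ℝ≥0 :=
  min (M.p y.1.1 * M.q y.1.1 y.2.1 * avg y.1.2) (M.p y.2.1 * M.q y.2.1 y.1.1 * avg y.2.2)

theorem measurable_pmDensity :
    Measurable (M.pmDensity : X × (Fin r → ℝ≥0) → ℝ≥0) :=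
  (M.measurable_p.comp measurable_fst).mul (measurable_avg.comp measurable_snd)

theorem measurable_flow : Measurable (M.flow (r := r)) := by
  have hp := M.measurable_p
  have ha := measurable_avg (r := r)
  have hq1 : Measurable fun a : (X × (Fin r → ℝ≥0)) × (X × (Fin r → ℝ≥0)) => M.q a.1.1 a.2.1 :=
    M.measurable_q.comp (by fun_prop : Measurable fun
      a : (X × (Fin r → ℝ≥0)) × (X × (Fin r → ℝ≥0)) => (a.1.1, a.2.1))
  have hq2 : Measurable fun a : (X × (Fin r → ℝ≥0)) × (X × (Fin r → ℝ≥0)) => M.q a.2.1 a.1.1 :=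
    M.measurable_q.comp (by fun_prop : Measurable fun
      a : (X × (Fin r → ℝ≥0)) × (X × (Fin r → ℝ≥0)) => (a.2.1, a.1.1))
  unfold flow
  fun_prop

theorem flow_swap (y : (X × (Fin r → ℝ≥0)) × (X × (Fin r → ℝ≥0))) :
    M.flow y.swap = M.flow y := min_comm _ _

theorem pmDensity_mul_accept (z z' : X × (Fin r → ℝ≥0)) :
    M.pmDensity z * (M.q z.1 z'.1 * M.accept z z') = M.flow (z, z') := by
  unfold pmDensity accept flow ratio
  split_ifs with h
  -- When the denominator vanishes both sides are zero, whatever the convention for acceptance.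
  · have h' : M.p z.1 * avg z.2 * (M.q z.1 z'.1 * 1) = M.p z.1 * M.q z.1 z'.1 * avg z.2 := by ring
    rw [h', h, min_eq_left zero_le]
  · have hA : 0 < M.p z.1 * M.q z.1 z'.1 * avg z.2 := pos_iff_ne_zero.2 h
    have h' : ∀ t, M.p z.1 * avg z.2 * (M.q z.1 z'.1 * t) =
      M.p z.1 * M.q z.1 z'.1 * avg z.2 * t := fun t => by ring
    rw [h', mul_min_of_nonneg _ _ hA.le, mul_one]
    congr 1
    have h1 : M.p z.1 ≠ 0 := fun h0 => h (by simp [h0])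
    have h2 : M.q z.1 z'.1 ≠ 0 := fun h0 => h (by simp [h0])
    have h3 : avg z.2 ≠ 0 := fun h0 => h (by simp [h0])
    field_simp

variable [IsMarkovKernel κ]

instance : SFinite (M.pmTarget κ) := by
  unfold pmTarget; infer_instance

theorem lintegral_pmTarget {F : X × (Fin r → ℝ≥0) → ℝ≥0∞} (hF : Measurable F) :
    ∫⁻ z, F z ∂(M.pmTarget κ) = ∫⁻ z, M.pmDensity z * F z ∂(M.refMeasure κ) := by
  have ha : Measurable fun z : X × (Fin r → ℝ≥0) => (avg z.2 : ℝ≥0∞) :=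
    measurable_coe_nnreal_ennreal.comp (measurable_avg.comp measurable_snd)
  rw [pmTarget, lintegral_withDensity_eq_lintegral_mul _ ha hF, target, refMeasure,
    lintegral_withDensity_compProd _ _ M.measurable_p (ha.mul hF)]
  refine lintegral_congr fun z => ?_
  simp only [pmDensity, Pi.mul_apply, ENNReal.coe_mul, mul_assoc]

theorem measurePreserving_fst_pmTarget (hκ : ∀ x, ∫⁻ w, (avg w : ℝ≥0∞) ∂(κ x) = 1) :
    MeasurePreserving Prod.fst (M.pmTarget κ) M.target := by
  have ha : Measurable fun z : X × (Fin r → ℝ≥0) => (avg z.2 : ℝ≥0∞) :=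
    measurable_coe_nnreal_ennreal.comp (measurable_avg.comp measurable_snd)
  refine ⟨measurable_fst, Measure.ext_of_lintegral _ fun F hF => ?_⟩
  have hF' : Measurable fun z : X × (Fin r → ℝ≥0) => F z.1 := hF.comp measurable_fst
  rw [lintegral_map hF measurable_fst, pmTarget, lintegral_withDensity_eq_lintegral_mul _ ha
    hF', Measure.lintegral_compProd (ha.mul hF')]
  refine lintegral_congr fun x => ?_
  simp only [Pi.mul_apply]
  have ha' : Measurable fun w : Fin r → ℝ≥0 => (avg w : ℝ≥0∞) :=
    measurable_coe_nnreal_ennreal.comp measurable_avg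
  rw [lintegral_mul_const _ ha', hκ, one_mul]

theorem isProbabilityMeasure_pmTarget (hκ : ∀ x, ∫⁻ w, (avg w : ℝ≥0∞) ∂(κ x) = 1) :
    IsProbabilityMeasure (M.pmTarget κ) :=
  ⟨by simpa using ((M.measurePreserving_fst_pmTarget κ hκ).measure_preimage
    MeasurableSet.univ.nullMeasurableSet)⟩

theorem lintegral_pmProposal {F : X × (Fin r → ℝ≥0) → ℝ≥0∞} (hF : Measurable F)
    (z : X × (Fin r → ℝ≥0)) :
    ∫⁻ z', F z' ∂(M.pmProposal κ z) = ∫⁻ z', M.q z.1 z'.1 * F z' ∂(M.refMeasure κ) := by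
  have hq : Measurable (Function.uncurry fun x x' => (M.q x x' : ℝ≥0∞)) :=
    measurable_coe_nnreal_ennreal.comp M.measurable_q
  have hq' : Measurable fun z' : X × (Fin r → ℝ≥0) => (M.q z.1 z'.1 : ℝ≥0∞) :=
    (hq.comp measurable_prodMk_left).comp measurable_fst
  have hqF : Measurable fun z' : X × (Fin r → ℝ≥0) => (M.q z.1 z'.1 : ℝ≥0∞) * F z' := hq'.mul hF
  rw [pmProposal, Kernel.comap_apply, Kernel.lintegral_compProd _ _ _ hF, proposal]
  simp only [Kernel.prodMkLeft_apply]
  rw [Kernel.lintegral_withDensity _ hq _ hF.lintegral_kernel_prod_right', Kernel.const_apply,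
    refMeasure, Measure.lintegral_compProd hqF]
  refine lintegral_congr fun x => ?_
  exact (lintegral_const_mul _ (hF.comp measurable_prodMk_left)).symm

/-- Splits consecutive states into rejections, carried by the diagonal, and accepted moves, with
density `flow`. Both parts are invariant under swapping, which gives detailed balance. -/
theorem lintegral_pmTarget_compProd
    {F : (X × (Fin r → ℝ≥0)) × (X × (Fin r → ℝ≥0)) → ℝ≥0∞} (hF : Measurable F) :
    ∫⁻ y, F y ∂(M.pmTarget κ ⊗ₘ M.pmKernel κ) =
      ∫⁻ z, (1 - ∫⁻ z', M.accept z z' ∂(M.pmProposal κ z)) * F (z, z) ∂(M.pmTarget κ) +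
        ∫⁻ y, M.flow y * F y ∂((M.refMeasure κ).prod (M.refMeasure κ)) := by
  have hA : Measurable (Function.uncurry
      (M.accept : X × (Fin r → ℝ≥0) → X × (Fin r → ℝ≥0) → ℝ≥0)) := M.measurable_accept
  have hA' : Measurable fun y : (X × (Fin r → ℝ≥0)) × (X × (Fin r → ℝ≥0)) =>
      (M.accept y.1 y.2 : ℝ≥0∞) := measurable_coe_nnreal_ennreal.comp hA
  have hmul : Measurable fun y => (M.accept y.1 y.2 : ℝ≥0∞) * F y := hA'.mul hF
  have hflow : Measurable fun y => (M.flow y : ℝ≥0∞) * F y :=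
    (measurable_coe_nnreal_ennreal.comp M.measurable_flow).mul hF
  have hdiag : Measurable fun z : X × (Fin r → ℝ≥0) => (z, z) := by fun_prop
  rw [Measure.lintegral_compProd hF]
  have hker : ∀ z, ∫⁻ z', F (z, z') ∂(M.pmKernel κ z) =
      (1 - ∫⁻ z', M.accept z z' ∂(M.pmProposal κ z)) * F (z, z) +
        ∫⁻ z', M.accept z z' * F (z, z') ∂(M.pmProposal κ z) := fun z =>
    lintegral_acceptReject (M.pmProposal κ) hA (hF.comp (measurable_prodMk_left (x := z))) z
  simp_rw [hker]
  rw [lintegral_add_left]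
  · congr 1
    rw [lintegral_pmTarget _ _ hmul.lintegral_kernel_prod_right', lintegral_prod _
      hflow.aemeasurable]
    refine lintegral_congr fun z => ?_
    have hz : Measurable fun z' => (M.accept z z' : ℝ≥0∞) * F (z, z') :=
      hmul.comp measurable_prodMk_left
    rw [lintegral_pmProposal _ _ hz, ← lintegral_const_mul]
    · refine lintegral_congr fun z' => ?_
      rw [← pmDensity_mul_accept]
      push_cast
      ring
    · have hq : Measurable fun z' : X × (Fin r → ℝ≥0) => (M.q z.1 z'.1 : ℝ≥0∞) :=
        measurable_coe_nnreal_ennreal.comp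
          ((M.measurable_q.comp measurable_prodMk_left).comp measurable_fst)
      exact hq.mul hz
  · exact (measurable_const.sub hA'.lintegral_kernel_prod_right').mul (hF.comp hdiag)

theorem detailedBalance_pmKernel (hκ : ∀ x, ∫⁻ w, (avg w : ℝ≥0∞) ∂(κ x) = 1) :
    DetailedBalance (M.pmTarget κ) (M.pmKernel κ) := by
  have := M.isProbabilityMeasure_pmTarget κ hκ
  refine Measure.ext_of_lintegral _ fun F hF => ?_
  have hF' : Measurable fun y : (X × (Fin r → ℝ≥0)) × (X × (Fin r → ℝ≥0)) => F y.swap :=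
    hF.comp measurable_swap
  rw [lintegral_map hF measurable_swap, lintegral_pmTarget_compProd M κ hF,
    lintegral_pmTarget_compProd M κ hF', ← lintegral_prod_swap]
  simp only [flow_swap, Prod.swap_swap]
  rfl

end Setup

/-! ### Cyclic windows of s weights and their relative averages. -/

namespace Setup

section Shift

variable {X : Type*} {s m : ℕ} [NeZero m]

/-- Keep `s` cyclically consecutive weights out of `m`, the first one having index `j`. -/
def shift (h : s ≤ m) (j : Fin m) (z : X × (Fin m → ℝ≥0)) : X × (Fin s → ℝ≥0) :=
  (z.1, fun i => z.2 (Fin.castLE h i + j))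

/-- The average of the weights kept by `shift`, relative to the average of all weights. -/
noncomputable def shiftRatio (h : s ≤ m) (j : Fin m) (z : X × (Fin m → ℝ≥0)) : ℝ≥0 :=
  avg (shift h j z).2 / avg z.2

/-- The conditional mean of `g` given all the weights. -/
noncomputable def shiftMean (h : s ≤ m) (g : X × (Fin s → ℝ≥0) → ℝ) (z : X × (Fin m → ℝ≥0)) : ℝ :=
  (m : ℝ)⁻¹ * ∑ j, shiftRatio h j z * g (shift h j z)

/-- Addition in `Fin m` is modulo m, so each weight lies in exactly s of the m windows. -/
theorem sum_avg_shift (hs : 0 < s) (h : s ≤ m) (z : X × (Fin m → ℝ≥0)) :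
    ∑ j, avg (shift h j z).2 = m * avg z.2 := by
  have hs' : (s : ℝ≥0) ≠ 0 := by exact_mod_cast hs.ne'
  have hm' : (m : ℝ≥0) ≠ 0 := by exact_mod_cast NeZero.ne m
  simp only [avg, shift]
  rw [← Finset.sum_div, Finset.sum_comm]
  have : ∀ i : Fin s, ∑ j, z.2 (Fin.castLE h i + j) = ∑ j, z.2 j := fun i =>
    Equiv.sum_comp (Equiv.addLeft (Fin.castLE h i)) z.2
  simp only [this, Finset.sum_const, Finset.card_univ, Fintype.card_fin, nsmul_eq_mul]
  field_simp

theorem mul_avg_shift_le (hs : 0 < s) (h : s ≤ m) (j : Fin m) (z : X × (Fin m → ℝ≥0)) :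
    s * avg (shift h j z).2 ≤ m * avg z.2 := by
  have hs' : (s : ℝ≥0) ≠ 0 := by exact_mod_cast hs.ne'
  have hm' : (m : ℝ≥0) ≠ 0 := by exact_mod_cast NeZero.ne m
  simp only [avg, shift]
  rw [mul_div_cancel₀ _ hs', mul_div_cancel₀ _ hm']
  have hinj : Function.Injective fun i : Fin s => Fin.castLE h i + j :=
    (add_left_injective j).comp (Fin.castLE_injective h)
  calc ∑ i, z.2 (Fin.castLE h i + j) = ∑ i ∈ Finset.univ.map ⟨_, hinj⟩, z.2 i := by
        rw [Finset.sum_map]; rfl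
    _ ≤ ∑ i, z.2 i := Finset.sum_le_sum_of_subset (Finset.subset_univ _)

/-- Holds even when the full average is zero and the ratio defaults to zero, since every window
average then vanishes too. -/
theorem shiftRatio_mul_avg (hs : 0 < s) (h : s ≤ m) (j : Fin m) (z : X × (Fin m → ℝ≥0)) :
    shiftRatio h j z * avg z.2 = avg (shift h j z).2 := by
  by_cases h0 : avg z.2 = 0
  · have h1 := mul_avg_shift_le hs h j z
    rw [h0, mul_zero, nonpos_iff_eq_zero, mul_eq_zero] at h1
    rw [h0, mul_zero, h1.resolve_left (by exact_mod_cast hs.ne')]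
  · exact div_mul_cancel₀ _ h0

theorem mul_shiftRatio_le (hs : 0 < s) (h : s ≤ m) (j : Fin m) (z : X × (Fin m → ℝ≥0)) :
    s * shiftRatio h j z ≤ m := by
  rw [shiftRatio, ← mul_div_assoc]
  exact div_le_of_le_mul₀ zero_le zero_le (mul_avg_shift_le hs h j z)

theorem sum_shiftRatio (hs : 0 < s) (h : s ≤ m) {z : X × (Fin m → ℝ≥0)} (hz : avg z.2 ≠ 0) :
    ∑ j, shiftRatio h j z = m := by
  simp only [shiftRatio]
  rw [← Finset.sum_div, sum_avg_shift hs, mul_div_cancel_right₀ _ hz]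

theorem sum_shiftRatio_le (hs : 0 < s) (h : s ≤ m) (z : X × (Fin m → ℝ≥0)) :
    ∑ j, shiftRatio h j z ≤ m := by
  by_cases hz : avg z.2 = 0
  · simp [shiftRatio, hz]
  · exact (sum_shiftRatio hs h hz).le

theorem shiftMean_sq_le (hs : 0 < s) (h : s ≤ m) (g : X × (Fin s → ℝ≥0) → ℝ)
    (z : X × (Fin m → ℝ≥0)) :
    shiftMean h g z ^ 2 ≤ (m : ℝ)⁻¹ * ∑ j, shiftRatio h j z * g (shift h j z) ^ 2 := by
  have hm : (0 : ℝ) < m := by exact_mod_cast NeZero.pos m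
  have h1 := Finset.sum_sq_le_sum_mul_sum_of_sq_le_mul Finset.univ
    (r := fun j => shiftRatio h j z * g (shift h j z)) (f := fun j => (shiftRatio h j z : ℝ))
    (g := fun j => shiftRatio h j z * g (shift h j z) ^ 2)
    (fun j _ => by positivity) (fun j _ => by positivity) (fun j _ => le_of_eq (by ring))
  have h2 : ∑ j, (shiftRatio h j z : ℝ) ≤ m := by exact_mod_cast sum_shiftRatio_le hs h z
  have h3 : 0 ≤ ∑ j, (shiftRatio h j z : ℝ) * g (shift h j z) ^ 2 :=
    Finset.sum_nonneg fun j _ => by positivity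
  rw [shiftMean, mul_pow]
  calc ((m : ℝ)⁻¹) ^ 2 * (∑ j, shiftRatio h j z * g (shift h j z)) ^ 2
      ≤ ((m : ℝ)⁻¹) ^ 2 * (m * ∑ j, (shiftRatio h j z : ℝ) * g (shift h j z) ^ 2) := by
        gcongr
        exact h1.trans (by gcongr)
    _ = _ := by field_simp

/-- Cauchy–Schwarz over independently chosen windows. Nonzero averages make the weights R_i(z)
R_j(z') sum to m², so the difference of means is the mean of the differences. -/
theorem shiftMean_sub_sq_le (hs : 0 < s) (h : s ≤ m) (g : X × (Fin s → ℝ≥0) → ℝ)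
    {z z' : X × (Fin m → ℝ≥0)} (hz : avg z.2 ≠ 0) (hz' : avg z'.2 ≠ 0) :
    (shiftMean h g z - shiftMean h g z') ^ 2 ≤ ((m : ℝ) ^ 2)⁻¹ * ∑ i : Fin m × Fin m,
      shiftRatio h i.1 z * shiftRatio h i.2 z' * (g (shift h i.1 z) - g (shift h i.2 z')) ^ 2 := by
  have hm : (0 : ℝ) < m := by exact_mod_cast NeZero.pos m
  have e1 : ∑ j, (shiftRatio h j z : ℝ) = m := by exact_mod_cast sum_shiftRatio hs h hz
  have e2 : ∑ j, (shiftRatio h j z' : ℝ) = m := by exact_mod_cast sum_shiftRatio hs h hz'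
  have h1 := Finset.sum_sq_le_sum_mul_sum_of_sq_le_mul (Finset.univ : Finset (Fin m × Fin m))
    (r := fun i => shiftRatio h i.1 z * shiftRatio h i.2 z' *
      (g (shift h i.1 z) - g (shift h i.2 z')))
    (f := fun i => (shiftRatio h i.1 z * shiftRatio h i.2 z' : ℝ))
    (g := fun i => shiftRatio h i.1 z * shiftRatio h i.2 z' *
      (g (shift h i.1 z) - g (shift h i.2 z')) ^ 2)
    (fun j _ => by positivity) (fun j _ => by positivity) (fun j _ => le_of_eq (by ring))
  have e3 : ∑ i : Fin m × Fin m, (shiftRatio h i.1 z * shiftRatio h i.2 z' : ℝ) = m ^ 2 := by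
    rw [Fintype.sum_prod_type]
    simp only [← Finset.mul_sum, ← Finset.sum_mul, e1, e2]
    ring
  have e4 : ∑ i : Fin m × Fin m, shiftRatio h i.1 z * shiftRatio h i.2 z' *
      (g (shift h i.1 z) - g (shift h i.2 z')) =
      m ^ 2 * (shiftMean h g z - shiftMean h g z') := by
    have e5 : ∀ i j, (shiftRatio h i z * shiftRatio h j z' *
      (g (shift h i z) - g (shift h j z')) : ℝ) =
      shiftRatio h i z * g (shift h i z) * shiftRatio h j z' -
        shiftRatio h i z * (shiftRatio h j z' * g (shift h j z')) := fun i j => by ring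
    rw [Fintype.sum_prod_type]
    simp only [e5, Finset.sum_sub_distrib, ← Finset.mul_sum, ← Finset.sum_mul, e1, e2, shiftMean]
    field_simp
  rw [e3, e4, mul_pow] at h1
  rw [← div_eq_inv_mul, le_div_iff₀ (by positivity)]
  have h2 : (0 : ℝ) < m ^ 2 := by positivity
  nlinarith

end Shift

/-! ### Comparison of the two chains through windows. -/

variable {X : Type*} [MeasurableSpace X] (M : Setup X) {s m : ℕ} {κ : Kernel X (Fin m → ℝ≥0)}

theorem lintegral_avg_eq_one {r : ℕ} (hr : 0 < r) {ν : Measure (Fin r → ℝ≥0)}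
    (hν : ∀ i, ∫⁻ w, (w i : ℝ≥0∞) ∂ν = 1) : ∫⁻ w, (avg w : ℝ≥0∞) ∂ν = 1 := by
  have hr' : (r : ℝ≥0) ≠ 0 := by exact_mod_cast hr.ne'
  have e : ∀ w : Fin r → ℝ≥0, (avg w : ℝ≥0∞) = (∑ i, (w i : ℝ≥0∞)) * (r : ℝ≥0∞)⁻¹ := fun w => by
    rw [avg, ENNReal.coe_div hr', div_eq_mul_inv]
    simp
  simp_rw [e]
  rw [lintegral_mul_const _ (by fun_prop), lintegral_finsetSum _ fun i _ => by fun_prop]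
  simp only [hν, Finset.sum_const, Finset.card_univ, Fintype.card_fin, nsmul_eq_mul, mul_one]
  exact ENNReal.mul_inv_cancel (by exact_mod_cast hr.ne') (ENNReal.natCast_ne_top r)

theorem lintegral_avg_firstWeights (hs : 0 < s) (h : s ≤ m)
    (hmean : ∀ x i, ∫⁻ w, (w i : ℝ≥0∞) ∂(κ x) = 1) (x : X) :
    ∫⁻ w, (avg w : ℝ≥0∞) ∂(firstWeights h κ x) = 1 := by
  refine lintegral_avg_eq_one hs fun i => ?_
  rw [firstWeights, Kernel.map_apply _ (by fun_prop), lintegral_map (by fun_prop) (by fun_prop)]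
  exact hmean x _

theorem measurable_shift (h : s ≤ m) (j : Fin m) : Measurable (shift (X := X) h j) := by
  unfold shift; fun_prop

/-- Exchangeability enters here, through rotations of the coordinates. -/
theorem firstWeights_eq_map (hexch : ∀ x, Exchangeable (κ x)) (h : s ≤ m) (j : Fin m) (x : X) :
    firstWeights h κ x = (κ x).map fun w i => w (Fin.castLE h i + j) := by
  have : NeZero m := ⟨j.pos.ne'⟩
  rw [firstWeights, Kernel.map_apply _ (by fun_prop)]
  conv_lhs => rw [← hexch x (Equiv.addRight j)]
  rw [Measure.map_map (by fun_prop) (by fun_prop)]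
  rfl

theorem measurable_shiftRatio (h : s ≤ m) (j : Fin m) : Measurable (shiftRatio (X := X) h j) :=
  (measurable_avg.comp (measurable_snd.comp (measurable_shift h j))).div
    (measurable_avg.comp measurable_snd)

theorem measurable_shiftMean (h : s ≤ m) {g : X × (Fin s → ℝ≥0) → ℝ} (hg : Measurable g) :
    Measurable (shiftMean h g) :=
  measurable_const.mul <| Finset.measurable_sum _ fun j _ =>
    (measurable_shiftRatio h j).coe_nnreal_real.mul (hg.comp (measurable_shift h j))

theorem measurePreserving_shift [IsMarkovKernel κ] (hexch : ∀ x, Exchangeable (κ x)) (h : s ≤ m)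
    (j : Fin m) :
    MeasurePreserving (shift h j) (M.refMeasure κ) (M.refMeasure (firstWeights h κ)) := by
  refine ⟨measurable_shift h j, Measure.ext_of_lintegral _ fun F hF => ?_⟩
  have hF' : Measurable fun z : X × (Fin m → ℝ≥0) => F (shift h j z) :=
    hF.comp (measurable_shift h j)
  rw [lintegral_map hF (measurable_shift h j), refMeasure, refMeasure,
    Measure.lintegral_compProd hF', Measure.lintegral_compProd hF]
  refine lintegral_congr fun x => ?_
  rw [firstWeights_eq_map hexch h j]
  exact (lintegral_map (hF.comp measurable_prodMk_left) (by fun_prop)).symm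

variable [NeZero m]

/-- In each argument of the minimum one ratio turns the full average into the window average, and
the other is absorbed by s/m because s R ≤ m. -/
theorem flow_mul_shiftRatio_le (hs : 0 < s) (h : s ≤ m) (z z' : X × (Fin m → ℝ≥0)) (i j : Fin m) :
    (s / m : ℝ≥0) * (M.flow (z, z') * (shiftRatio h i z * shiftRatio h j z')) ≤
      M.flow (shift h i z, shift h j z') := by
  have hm : (0 : ℝ≥0) < m := by exact_mod_cast NeZero.pos m
  have hr : ∀ i (z : X × (Fin m → ℝ≥0)), (s / m : ℝ≥0) * shiftRatio h i z ≤ 1 := fun i z => by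
    rw [div_mul_eq_mul_div]
    exact div_le_one_of_le₀ (mul_shiftRatio_le hs h i z) zero_le
  unfold flow
  refine le_min ?_ ?_
  · calc _ ≤ (s / m : ℝ≥0) * (M.p z.1 * M.q z.1 z'.1 * avg z.2 *
          (shiftRatio h i z * shiftRatio h j z')) := by gcongr; exact min_le_left _ _
      _ = M.p z.1 * M.q z.1 z'.1 * (shiftRatio h i z * avg z.2) *
          ((s / m : ℝ≥0) * shiftRatio h j z') := by ring
      _ ≤ M.p z.1 * M.q z.1 z'.1 * (shiftRatio h i z * avg z.2) * 1 := by gcongr; exact hr _ _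
      _ = _ := by rw [mul_one, shiftRatio_mul_avg hs]; rfl
  · calc _ ≤ (s / m : ℝ≥0) * (M.p z'.1 * M.q z'.1 z.1 * avg z'.2 *
          (shiftRatio h i z * shiftRatio h j z')) := by gcongr; exact min_le_right _ _
      _ = M.p z'.1 * M.q z'.1 z.1 * (shiftRatio h j z' * avg z'.2) *
          ((s / m : ℝ≥0) * shiftRatio h i z) := by ring
      _ ≤ M.p z'.1 * M.q z'.1 z.1 * (shiftRatio h j z' * avg z'.2) * 1 := by gcongr; exact hr _ _
      _ = _ := by rw [mul_one, shiftRatio_mul_avg hs]; rfl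

theorem flow_mul_shiftMean_sub_sq_le (hs : 0 < s) (h : s ≤ m) (g : X × (Fin s → ℝ≥0) → ℝ)
    (z z' : X × (Fin m → ℝ≥0)) :
    (s / m : ℝ) * (M.flow (z, z') * (shiftMean h g z - shiftMean h g z') ^ 2) ≤
      ((m : ℝ) ^ 2)⁻¹ * ∑ i : Fin m × Fin m, M.flow (shift h i.1 z, shift h i.2 z') *
        (g (shift h i.1 z) - g (shift h i.2 z')) ^ 2 := by
  -- A zero average breaks the normalisation of the ratios, but the flow is then zero.
  by_cases h0 : avg z.2 = 0 ∨ avg z'.2 = 0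
  · have hf : M.flow (z, z') = 0 := by
      unfold flow
      rcases h0 with h0 | h0 <;> simp [h0]
    rw [hf]
    simp only [NNReal.coe_zero, zero_mul, mul_zero]
    positivity
  · push Not at h0
    calc _ ≤ (s / m : ℝ) * (M.flow (z, z') * (((m : ℝ) ^ 2)⁻¹ * ∑ i : Fin m × Fin m,
          shiftRatio h i.1 z * shiftRatio h i.2 z' *
            (g (shift h i.1 z) - g (shift h i.2 z')) ^ 2)) := by
          gcongr
          exact shiftMean_sub_sq_le hs h g h0.1 h0.2
      _ = ((m : ℝ) ^ 2)⁻¹ * ∑ i : Fin m × Fin m,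
          ((s / m : ℝ) * (M.flow (z, z') * (shiftRatio h i.1 z * shiftRatio h i.2 z'))) *
            (g (shift h i.1 z) - g (shift h i.2 z')) ^ 2 := by
          simp only [Finset.mul_sum]
          refine Finset.sum_congr rfl fun i _ => by ring
      _ ≤ _ := by
          gcongr with i
          exact_mod_cast M.flow_mul_shiftRatio_le hs h z z' i.1 i.2

variable [IsMarkovKernel κ]

/-- The reference law is preserved by the window map, and the invariant density at the window is the
original density times the ratio. -/
theorem measurePreserving_shift_pmTarget (hexch : ∀ x, Exchangeable (κ x)) (hs : 0 < s)
    (h : s ≤ m) (j : Fin m) :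
    MeasurePreserving (shift h j) ((M.pmTarget κ).withDensity fun z => (shiftRatio h j z : ℝ≥0∞))
      (M.pmTarget (firstWeights h κ)) := by
  refine ⟨measurable_shift h j, Measure.ext_of_lintegral _ fun F hF => ?_⟩
  have hr : Measurable fun z : X × (Fin m → ℝ≥0) => (shiftRatio h j z : ℝ≥0∞) :=
    measurable_coe_nnreal_ennreal.comp (measurable_shiftRatio h j)
  have hd : Measurable fun z : X × (Fin s → ℝ≥0) => (M.pmDensity z : ℝ≥0∞) :=
    measurable_coe_nnreal_ennreal.comp M.measurable_pmDensity
  have hF' : Measurable fun z : X × (Fin m → ℝ≥0) => F (shift h j z) :=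
    hF.comp (measurable_shift h j)
  have hdF : Measurable fun z => (M.pmDensity z : ℝ≥0∞) * F z := hd.mul hF
  rw [lintegral_map hF (measurable_shift h j), lintegral_withDensity_eq_lintegral_mul _ hr hF',
    lintegral_pmTarget _ _ (hr.mul hF'), lintegral_pmTarget _ _ hF,
    ← (M.measurePreserving_shift hexch h j).lintegral_comp hdF]
  refine lintegral_congr fun z => ?_
  have e : M.pmDensity (shift h j z) = M.pmDensity z * shiftRatio h j z := by
    rw [pmDensity, pmDensity, ← shiftRatio_mul_avg hs h j z, mul_comm (shiftRatio h j z),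
      mul_assoc]
    rfl
  simp only [Pi.mul_apply, e, ENNReal.coe_mul, mul_assoc]

theorem integrable_shiftRatio_mul (hexch : ∀ x, Exchangeable (κ x)) (hs : 0 < s)
    (h : s ≤ m) {G : X × (Fin s → ℝ≥0) → ℝ}
    (hG : Integrable G (M.pmTarget (firstWeights h κ))) (j : Fin m) :
    Integrable (fun z => shiftRatio h j z * G (shift h j z)) (M.pmTarget κ) := by
  have h1 := (M.measurePreserving_shift_pmTarget hexch hs h j).integrable_comp_of_integrable hG
  exact (integrable_withDensity_iff_integrable_smul (measurable_shiftRatio h j)).1 h1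

theorem integral_shiftRatio_mul (hexch : ∀ x, Exchangeable (κ x)) (hs : 0 < s)
    (h : s ≤ m) {G : X × (Fin s → ℝ≥0) → ℝ}
    (hG : Integrable G (M.pmTarget (firstWeights h κ))) (j : Fin m) :
    ∫ z, shiftRatio h j z * G (shift h j z) ∂(M.pmTarget κ) =
      ∫ z, G z ∂(M.pmTarget (firstWeights h κ)) := by
  have hp := M.measurePreserving_shift_pmTarget hexch hs h j
  have h1 := integral_map hp.measurable.aemeasurable (f := G)
    (by rw [hp.map_eq]; exact hG.aestronglyMeasurable)
  rw [hp.map_eq, integral_withDensity_eq_integral_smul (measurable_shiftRatio h j)] at h1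
  exact h1.symm

theorem memLp_shiftMean (hexch : ∀ x, Exchangeable (κ x)) (hs : 0 < s)
    (h : s ≤ m) {g : X × (Fin s → ℝ≥0) → ℝ} (hgm : Measurable g)
    (hg : MemLp g 2 (M.pmTarget (firstWeights h κ))) :
    MemLp (shiftMean h g) 2 (M.pmTarget κ) := by
  have hk := (measurable_shiftMean h hgm).aestronglyMeasurable (μ := M.pmTarget κ)
  refine (memLp_two_iff_integrable_sq hk).2 ?_
  have hi : Integrable (fun z => (m : ℝ)⁻¹ * ∑ j, shiftRatio h j z * g (shift h j z) ^ 2)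
      (M.pmTarget κ) :=
    (integrable_finsetSum _ fun j _ =>
      M.integrable_shiftRatio_mul hexch hs h hg.integrable_sq j).const_mul _
  refine hi.mono' (hk.pow 2) (Eventually.of_forall fun z => ?_)
  rw [Real.norm_of_nonneg (sq_nonneg _)]
  exact shiftMean_sq_le hs h g z

theorem integral_mul_shiftMean (hexch : ∀ x, Exchangeable (κ x)) (hs : 0 < s)
    (h : s ≤ m) {f : X → ℝ} {g : X × (Fin s → ℝ≥0) → ℝ}
    (hfg : Integrable (fun z => f z.1 * g z) (M.pmTarget (firstWeights h κ))) :
    ∫ z, f z.1 * shiftMean h g z ∂(M.pmTarget κ) =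
      ∫ z, f z.1 * g z ∂(M.pmTarget (firstWeights h κ)) := by
  have hm : (m : ℝ) ≠ 0 := by exact_mod_cast NeZero.ne m
  have e : ∀ z : X × (Fin m → ℝ≥0), f z.1 * shiftMean h g z =
      (m : ℝ)⁻¹ * ∑ j, shiftRatio h j z * (f (shift h j z).1 * g (shift h j z)) := fun z => by
    rw [shiftMean, mul_left_comm, Finset.mul_sum]
    congr 1
    exact Finset.sum_congr rfl fun j _ => mul_left_comm _ _ _
  simp_rw [e]
  rw [integral_const_mul, integral_finsetSum _ fun j _ =>
    M.integrable_shiftRatio_mul hexch hs h hfg j]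
  simp_rw [M.integral_shiftRatio_mul hexch hs h hfg]
  simp [hm]

/-- The Dirichlet energy only sees the accepted moves. -/
theorem lintegral_sub_sq_pmKernel {r : ℕ} (η : Kernel X (Fin r → ℝ≥0)) [IsMarkovKernel η]
    {g : X × (Fin r → ℝ≥0) → ℝ} (hg : Measurable g) :
    ∫⁻ y, ENNReal.ofReal ((g y.1 - g y.2) ^ 2) ∂(M.pmTarget η ⊗ₘ M.pmKernel η) =
      ∫⁻ y, ENNReal.ofReal (M.flow y * (g y.1 - g y.2) ^ 2)
        ∂((M.refMeasure η).prod (M.refMeasure η)) := by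
  rw [lintegral_pmTarget_compProd _ _ (by fun_prop)]
  simp [ENNReal.ofReal_mul]

theorem lintegral_shiftMean_sub_sq_le (hexch : ∀ x, Exchangeable (κ x)) (hs : 0 < s) (h : s ≤ m)
    {g : X × (Fin s → ℝ≥0) → ℝ} (hg : Measurable g) :
    ENNReal.ofReal (s / m) * ∫⁻ y, ENNReal.ofReal ((shiftMean h g y.1 - shiftMean h g y.2) ^ 2)
        ∂(M.pmTarget κ ⊗ₘ M.pmKernel κ) ≤
      ∫⁻ y, ENNReal.ofReal ((g y.1 - g y.2) ^ 2)
        ∂(M.pmTarget (firstWeights h κ) ⊗ₘ M.pmKernel (firstWeights h κ)) := by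
  have hm : (0 : ℝ) < m := by exact_mod_cast NeZero.pos m
  rw [M.lintegral_sub_sq_pmKernel κ (measurable_shiftMean h hg),
    M.lintegral_sub_sq_pmKernel _ hg, ← lintegral_const_mul' _ _ ENNReal.ofReal_ne_top]
  have hmeas : Measurable fun y : (X × (Fin s → ℝ≥0)) × (X × (Fin s → ℝ≥0)) =>
      ENNReal.ofReal (M.flow y * (g y.1 - g y.2) ^ 2) := by
    have := M.measurable_flow (r := s)
    fun_prop
  have hsh : ∀ i : Fin m × Fin m, Measurable
      fun y : (X × (Fin m → ℝ≥0)) × (X × (Fin m → ℝ≥0)) => ENNReal.ofReal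
        (M.flow (shift h i.1 y.1, shift h i.2 y.2) *
          (g (shift h i.1 y.1) - g (shift h i.2 y.2)) ^ 2) := fun i =>
    hmeas.comp ((measurable_shift h i.1).prodMap (measurable_shift h i.2))
  calc _ ≤ ∫⁻ y, ENNReal.ofReal ((m : ℝ) ^ 2)⁻¹ * ∑ i : Fin m × Fin m, ENNReal.ofReal
          (M.flow (shift h i.1 y.1, shift h i.2 y.2) *
            (g (shift h i.1 y.1) - g (shift h i.2 y.2)) ^ 2)
          ∂((M.refMeasure κ).prod (M.refMeasure κ)) := by
        refine lintegral_mono fun y => ?_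
        rw [← ENNReal.ofReal_mul (by positivity), ← ENNReal.ofReal_sum_of_nonneg
          fun i _ => by positivity, ← ENNReal.ofReal_mul (by positivity)]
        exact ENNReal.ofReal_le_ofReal (M.flow_mul_shiftMean_sub_sq_le hs h g y.1 y.2)
    _ = ENNReal.ofReal ((m : ℝ) ^ 2)⁻¹ * ∑ i : Fin m × Fin m,
          ∫⁻ y, ENNReal.ofReal (M.flow y * (g y.1 - g y.2) ^ 2)
            ∂((M.refMeasure (firstWeights h κ)).prod (M.refMeasure (firstWeights h κ))) := by
        rw [lintegral_const_mul' _ _ ENNReal.ofReal_ne_top,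
          lintegral_finsetSum _ fun i _ => hsh i]
        congr 1
        refine Finset.sum_congr rfl fun i _ => ?_
        exact ((M.measurePreserving_shift hexch h i.1).prod
          (M.measurePreserving_shift hexch h i.2)).lintegral_comp hmeas
    _ = _ := by
        rw [Finset.sum_const, Finset.card_univ, Fintype.card_prod, Fintype.card_fin, nsmul_eq_mul,
          ← mul_assoc]
        have : ENNReal.ofReal ((m : ℝ) ^ 2)⁻¹ * ((m * m : ℕ) : ℝ≥0∞) = 1 := by
          rw [← ENNReal.ofReal_natCast, ← ENNReal.ofReal_mul (by positivity)]
          push_cast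
          rw [← sq, inv_mul_cancel₀ (by positivity), ENNReal.ofReal_one]
        rw [this, one_mul]

theorem mul_dirichletFunctional_le (hexch : ∀ x, Exchangeable (κ x)) (hs : 0 < s) (h : s ≤ m)
    (hmean : ∀ x i, ∫⁻ w, (w i : ℝ≥0∞) ∂(κ x) = 1) {φ : X → ℝ} (hφ : MemLp φ 2 M.target)
    {g : X × (Fin s → ℝ≥0) → ℝ} (hgm : Measurable g)
    (hg : MemLp g 2 (M.pmTarget (firstWeights h κ))) :
    s * dirichletFunctional (M.pmTarget (firstWeights h κ)) (M.pmKernel (firstWeights h κ))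
        (fun z => φ z.1) g ≤
      m * dirichletFunctional (M.pmTarget κ) (M.pmKernel κ) (fun z => φ z.1)
        (fun z => (s / m : ℝ) * shiftMean h g z) := by
  have hm : (0 : ℝ) < m := by exact_mod_cast NeZero.pos m
  have hκm := fun x => lintegral_avg_eq_one (NeZero.pos m) (hmean x)
  have hκs := lintegral_avg_firstWeights hs h hmean
  have := M.isProbabilityMeasure_pmTarget κ hκm
  have := M.isProbabilityMeasure_pmTarget (firstWeights h κ) hκs
  have hk := M.memLp_shiftMean hexch hs h hgm hg
  have hpm := M.measurePreserving_fst_pmTarget κ hκm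
  have hps := M.measurePreserving_fst_pmTarget (firstWeights h κ) hκs
  have hmeanm : ∫ z, φ z.1 ∂(M.pmTarget κ) = ∫ x, φ x ∂M.target := by
    rw [← hpm.map_eq, integral_map hpm.measurable.aemeasurable
      (by rw [hpm.map_eq]; exact hφ.aestronglyMeasurable)]
  have hmeans : ∫ z, φ z.1 ∂(M.pmTarget (firstWeights h κ)) = ∫ x, φ x ∂M.target := by
    rw [← hps.map_eq, integral_map hps.measurable.aemeasurable
      (by rw [hps.map_eq]; exact hφ.aestronglyMeasurable)]
  have hfg : Integrable (fun z => (φ z.1 - ∫ x, φ x ∂M.target) * g z)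
      (M.pmTarget (firstWeights h κ)) :=
    ((hφ.sub (memLp_const _)).comp_measurePreserving hps).integrable_mul hg
  have hdbm := M.detailedBalance_pmKernel κ hκm
  have hdbs := M.detailedBalance_pmKernel (firstWeights h κ) hκs
  have hEm : Integrable (fun y => (shiftMean h g y.1 - shiftMean h g y.2) ^ 2)
      (M.pmTarget κ ⊗ₘ M.pmKernel κ) :=
    ((hk.comp_measurePreserving measurePreserving_fst_compProd).sub
      (hk.comp_measurePreserving hdbm.measurePreserving_snd)).integrable_sq
  have hEs : Integrable (fun y => (g y.1 - g y.2) ^ 2)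
      (M.pmTarget (firstWeights h κ) ⊗ₘ M.pmKernel (firstWeights h κ)) :=
    ((hg.comp_measurePreserving measurePreserving_fst_compProd).sub
      (hg.comp_measurePreserving hdbs.measurePreserving_snd)).integrable_sq
  have hE := M.lintegral_shiftMean_sub_sq_le hexch hs h hgm
  rw [← ofReal_integral_eq_lintegral_ofReal hEm (Eventually.of_forall fun _ => sq_nonneg _),
    ← ofReal_integral_eq_lintegral_ofReal hEs (Eventually.of_forall fun _ => sq_nonneg _),
    ← ENNReal.ofReal_mul (by positivity),
    ENNReal.ofReal_le_ofReal_iff (integral_nonneg fun _ => sq_nonneg _)] at hE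
  have e1 : ∀ z : X × (Fin m → ℝ≥0), (φ z.1 - ∫ x, φ x ∂M.target) * ((s / m : ℝ) *
      shiftMean h g z) = (s / m : ℝ) * ((φ z.1 - ∫ x, φ x ∂M.target) * shiftMean h g z) :=
    fun z => mul_left_comm _ _ _
  have e2 : ∀ y : (X × (Fin m → ℝ≥0)) × (X × (Fin m → ℝ≥0)),
      ((s / m : ℝ) * shiftMean h g y.1 - (s / m : ℝ) * shiftMean h g y.2) ^ 2 =
        (s / m : ℝ) ^ 2 * (shiftMean h g y.1 - shiftMean h g y.2) ^ 2 := fun y => by ring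
  rw [dirichletFunctional, dirichletFunctional, hmeanm, hmeans]
  simp_rw [e1, e2]
  rw [integral_const_mul, integral_const_mul,
    M.integral_mul_shiftMean (f := fun x => φ x - ∫ x, φ x ∂M.target) hexch hs h hfg]
  set I := ∫ z, (φ z.1 - ∫ x, φ x ∂M.target) * g z ∂(M.pmTarget (firstWeights h κ))
  set E := ∫ y, (shiftMean h g y.1 - shiftMean h g y.2) ^ 2 ∂(M.pmTarget κ ⊗ₘ M.pmKernel κ)
  -- The scaling s/m matches the linear terms, and m (s/m)² = s (s/m) leaves exactly the constant of
  -- the energy comparison.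
  have e3 : m * (2 * ((s / m : ℝ) * I) - 1 / 2 * ((s / m : ℝ) ^ 2 * E)) =
      s * (2 * I - 1 / 2 * ((s / m : ℝ) * E)) := by
    field_simp
  rw [e3]
  gcongr

theorem evariance_comp_fst {r : ℕ} {η : Kernel X (Fin r → ℝ≥0)} [IsMarkovKernel η]
    (hη : ∀ x, ∫⁻ w, (avg w : ℝ≥0∞) ∂(η x) = 1) {φ : X → ℝ} (hφ : MemLp φ 2 M.target) :
    evariance (fun z : X × (Fin r → ℝ≥0) => φ z.1) (M.pmTarget η) = evariance φ M.target := by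
  have := M.isProbabilityMeasure_pmTarget η hη
  have hp := M.measurePreserving_fst_pmTarget η hη
  have h := (hφ.comp_measurePreserving hp).ofReal_variance_eq
  simp only [Function.comp_def] at h
  rw [← h, ← hφ.ofReal_variance_eq]
  congr 1
  conv_rhs => rw [← hp.map_eq]
  rw [variance_map (by rw [hp.map_eq]; exact hφ.aestronglyMeasurable.aemeasurable)
    hp.measurable.aemeasurable]
  rfl

end Setup

end PseudoMarginal

/-! ### The main inequality. -/

theorem theorem1 {X : Type*} [MeasurableSpace X] (M : PseudoMarginal.Setup X)
    {s m : ℕ} (hs : 0 < s) (hsm : s ≤ m)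
    (κ : Kernel X (Fin m → ℝ≥0)) [IsMarkovKernel κ]
    (hexch : ∀ x, PseudoMarginal.Exchangeable (κ x))
    (hmean : ∀ x i, ∫⁻ w, (w i : ℝ≥0∞) ∂(κ x) = 1)
    (φ : X → ℝ) (hφ : MemLp φ 2 M.target) :
    M.HasAsympVar (PseudoMarginal.firstWeights hsm κ) φ ∧
    M.HasAsympVar κ φ ∧
    (s : ℝ≥0∞) * (M.pmAsympVar (PseudoMarginal.firstWeights hsm κ) φ + evariance φ M.target) ≤
      (m : ℝ≥0∞) * (M.pmAsympVar κ φ + evariance φ M.target) := by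
  have : NeZero m := ⟨(hs.trans_le hsm).ne'⟩
  have hκm := fun x => PseudoMarginal.Setup.lintegral_avg_eq_one (NeZero.pos m) (hmean x)
  have hκs := PseudoMarginal.Setup.lintegral_avg_firstWeights hs hsm hmean
  have := M.isProbabilityMeasure_pmTarget κ hκm
  have := M.isProbabilityMeasure_pmTarget (PseudoMarginal.firstWeights hsm κ) hκs
  have hdbm := M.detailedBalance_pmKernel κ hκm
  have hdbs := M.detailedBalance_pmKernel (PseudoMarginal.firstWeights hsm κ) hκs
  have hφm := hφ.comp_measurePreserving (M.measurePreserving_fst_pmTarget κ hκm)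
  have hφs := hφ.comp_measurePreserving
    (M.measurePreserving_fst_pmTarget (PseudoMarginal.firstWeights hsm κ) hκs)
  refine ⟨PseudoMarginal.tendsto_scaledVar hdbs hφs, PseudoMarginal.tendsto_scaledVar hdbm hφm, ?_⟩
  have h1 := PseudoMarginal.asympVar_add_evariance hdbs (f := fun z => φ z.1) hφs
  have h2 := PseudoMarginal.asympVar_add_evariance hdbm (f := fun z => φ z.1) hφm
  rw [M.evariance_comp_fst hκs hφ] at h1
  rw [M.evariance_comp_fst hκm hφ] at h2
  rw [PseudoMarginal.Setup.pmAsympVar, PseudoMarginal.Setup.pmAsympVar, h1, h2,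
    mul_left_comm, mul_left_comm (m : ℝ≥0∞)]
  gcongr 2 * ?_
  simp only [ENNReal.mul_iSup]
  refine iSup_le fun g => iSup_le fun hgm => iSup_le fun hg => ?_
  -- Each test function for the s-chain is beaten by its rescaled window mean for the m-chain.
  refine le_iSup_of_le (fun z => (s / m : ℝ) * PseudoMarginal.Setup.shiftMean hsm g z)
    (le_iSup_of_le (measurable_const.mul (PseudoMarginal.Setup.measurable_shiftMean hsm hgm))
      (le_iSup_of_le ((M.memLp_shiftMean hexch hs hsm hgm hg).const_mul _) ?_))
  rw [← ENNReal.ofReal_natCast, ← ENNReal.ofReal_natCast, ← ENNReal.ofReal_mul (by positivity),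
    ← ENNReal.ofReal_mul (by positivity)]
  exact ENNReal.ofReal_le_ofReal (M.mul_dirichletFunctional_le hexch hs hsm hmean hφ hgm hg)
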